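/- Let $\mathcal V$ be a symmetric monoidal closed category whose underlying ordinary category $\mathcal V_0$ is locally small, complete and cocomplete. "Category", "functor" and "natural transformation" mean $\mathcal V$-category, $\mathcal V$-functor and $\mathcal V$-natural transformation; a category is small when its isomorphism classes of objects form a small set. A weight is a functor $\phi:\mathcal K^{op}\to\mathcal V$ with $\mathcal K$ small. The limit $\{\phi,T\}$ of $T:\mathcal K^{op}\to\mathcal A$ is defined by $\mathcal A(a,\{\phi,T\})\cong[\mathcal K^{op},\mathcal V](\phi,\mathcal A(a,T-))$, and the colimit $\phi*S$ of $S:\mathcal K\to\mathcal A$ is the limit $\{\phi,S^{op}\}$ in $\mathcal A^{op}$. For a class $\Phi$ of weights, a category is $\Phi$-complete if it admits all limits with weights in $\Phi$, and a functor between $\Phi$-complete categories is $\Phi$-continuous if it preserves them. The saturation $\Phi^*$ of $\Phi$ is the class of all weights $\psi$ such that every $\Phi$-complete category is $\psi$-complete and every $\Phi$-continuous functor (between $\Phi$-complete categories) is $\psi$-continuous; $\Phi$ is saturated if $\Phi^*=\Phi$. For weights $\psi:\mathcal K^{op}\to\mathcal V$ and $\phi:\mathcal L^{op}\to\mathcal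 V$, say that $\phi$-colimits commute with $\psi$-limits in $\mathcal V$ if the functor $\{\psi,-\}=[\mathcal K^{op},\mathcal V](\psi,-):[\mathcal K^{op},\mathcal V]\to\mathcal V$ preserves $\phi$-colimits (equivalently, if $\phi*-:[\mathcal L,\mathcal V]\to\mathcal V$ preserves $\psi$-limits). For a class $\Psi$ of weights let $\Psi^+$ be the class of all weights $\phi$ (the $\Psi$-flat weights) such that $\phi$-colimits commute with $\psi$-limits in $\mathcal V$ for every $\psi\in\Psi$; for a class $\Phi$ of weights let $\Phi^-$ be the class of all weights $\psi$ (the $\Phi$-atomic weights) such that $\phi$-colimits commute with $\psi$-limits in $\mathcal V$ for every $\phi\in\Phi$. Proposition. For any classes $\Phi$ and $\Psi$ of weights, the classes $\Phi^-$ and $\Psi^+$ are saturated, so that $(\Psi^+)^*=\Psi^+$ and $(\Phi^-)^*=\Phi^-$. Moreover $\Psi^+=(\Psi^*)^+$ and $\Phi^-=(\Phi^*)^-$. -/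

import Mathlib

open CategoryTheory MonoidalCategory MonoidalClosed Limits

universe w u k t k' k''

/-!
Categories enriched in a symmetric monoidal closed category `V` (`V` being enriched in itself by
its internal hom), V-functors and opposites are those of Mathlib.  This file adds V-natural
transformations, functor V-categories, weighted limits and colimits, classes of weights and their
saturation, and the commutation of limits and colimits in `V`.
-/

namespace EnrichedWeights

section
variable {V : Type u} [Category.{w} V] [MonoidalCategory V]

section PrePost
variable {C : Type k} [EnrichedCategory V C]

/-- Precomposition `C(y, z) → C(x, z)` with an element `u` of `C(x, y)`. -/
def preC {x y : C} (u : 𝟙_ V ⟶ EnrichedCategory.Hom x y) (z : C) :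
    (EnrichedCategory.Hom y z : V) ⟶ EnrichedCategory.Hom x z :=
  (λ_ _).inv ≫ u ▷ _ ≫ eComp V x y z

/-- Postcomposition `C(x, y) → C(x, z)` with an element `u` of `C(y, z)`. -/
def postC (x : C) {y z : C} (u : 𝟙_ V ⟶ EnrichedCategory.Hom y z) :
    (EnrichedCategory.Hom x y : V) ⟶ EnrichedCategory.Hom x z :=
  (ρ_ _).inv ≫ _ ◁ u ≫ eComp V x y z

/-- The composite of an element of `C(x, y)` with an element of `C(y, z)`. -/
def compE {x y z : C} (u : 𝟙_ V ⟶ EnrichedCategory.Hom x y)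
    (v : 𝟙_ V ⟶ EnrichedCategory.Hom y z) : 𝟙_ V ⟶ EnrichedCategory.Hom x z :=
  (λ_ _).inv ≫ (u ⊗ₘ v) ≫ eComp V x y z

lemma preC_id (x z : C) : preC (eId V x) z = 𝟙 _ := by
  simp [preC]

lemma postC_id (x z : C) : postC x (eId V z) = 𝟙 _ := by
  simp [postC]

lemma comp_preC {x y : C} (u : 𝟙_ V ⟶ EnrichedCategory.Hom x y) (z t : C) :
    eComp V y z t ≫ preC u t = preC u z ▷ _ ≫ eComp V x z t := by
  simp only [preC, comp_whiskerRight, Category.assoc]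
  rw [leftUnitor_inv_naturality_assoc, whisker_exchange_assoc]
  simp [e_assoc']

lemma comp_postC (x y : C) {z t : C} (u : 𝟙_ V ⟶ EnrichedCategory.Hom z t) :
    eComp V x y z ≫ postC x u = _ ◁ postC y u ≫ eComp V x y t := by
  simp only [postC, MonoidalCategory.whiskerLeft_comp, Category.assoc]
  rw [rightUnitor_inv_naturality_assoc, ← whisker_exchange_assoc, ← e_assoc V x y z t]
  simp

lemma postC_comp_preC (x : C) {y z : C} (u : 𝟙_ V ⟶ EnrichedCategory.Hom y z) (t : C) :
    postC x u ▷ _ ≫ eComp V x z t = _ ◁ preC u t ≫ eComp V x y t := by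
  simp only [preC, postC, MonoidalCategory.whiskerLeft_comp, comp_whiskerRight, Category.assoc]
  rw [← e_assoc V x y z t]
  simp

lemma pre_post {x y z t : C} (u : 𝟙_ V ⟶ EnrichedCategory.Hom x y)
    (v : 𝟙_ V ⟶ EnrichedCategory.Hom z t) :
    preC u z ≫ postC x v = postC y v ≫ preC u t := by
  simp only [preC, Category.assoc, comp_postC]
  rw [← whisker_exchange_assoc, ← leftUnitor_inv_naturality_assoc]

lemma preC_preC {x y z : C} (u : 𝟙_ V ⟶ EnrichedCategory.Hom x y)
    (v : 𝟙_ V ⟶ EnrichedCategory.Hom y z) (t : C) :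
    preC v t ≫ preC u t = preC (compE u v) t := by
  simp only [preC, Category.assoc]
  rw [leftUnitor_inv_naturality_assoc, whisker_exchange_assoc]
  simp only [compE, tensorHom_def', comp_whiskerRight, Category.assoc, ← e_assoc' V x y z t]
  simp

lemma postC_postC (x : C) {y z t : C} (u : 𝟙_ V ⟶ EnrichedCategory.Hom y z)
    (v : 𝟙_ V ⟶ EnrichedCategory.Hom z t) :
    postC x u ≫ postC x v = postC x (compE u v) := by
  simp only [postC, Category.assoc]
  rw [rightUnitor_inv_naturality_assoc, ← whisker_exchange_assoc]
  simp only [compE, MonoidalCategory.tensorHom_def, MonoidalCategory.whiskerLeft_comp,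
    Category.assoc, ← e_assoc V x y z t]
  simp [unitors_inv_equal]

end PrePost

section Map
variable {C : Type k} [EnrichedCategory V C] {D : Type k'} [EnrichedCategory V D]
  (F : EnrichedFunctor V C D)

lemma preC_map {x y : C} (u : 𝟙_ V ⟶ EnrichedCategory.Hom x y) (z : C) :
    preC u z ≫ F.map x z = F.map y z ≫ preC (u ≫ F.map x y) (F.obj z) := by
  simp only [preC, Category.assoc, EnrichedFunctor.map_comp, comp_whiskerRight]
  rw [leftUnitor_inv_naturality_assoc, MonoidalCategory.tensorHom_def_assoc,
    whisker_exchange_assoc, ← whisker_exchange_assoc]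

lemma postC_map (x : C) {y z : C} (u : 𝟙_ V ⟶ EnrichedCategory.Hom y z) :
    postC x u ≫ F.map x z = F.map x y ≫ postC (F.obj x) (u ≫ F.map y z) := by
  simp only [postC, Category.assoc, EnrichedFunctor.map_comp, MonoidalCategory.whiskerLeft_comp]
  rw [rightUnitor_inv_naturality_assoc, MonoidalCategory.tensorHom_def'_assoc,
    ← whisker_exchange_assoc, whisker_exchange_assoc]

lemma compE_map {x y z : C} (u : 𝟙_ V ⟶ EnrichedCategory.Hom x y)
    (v : 𝟙_ V ⟶ EnrichedCategory.Hom y z) :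
    compE u v ≫ F.map x z = compE (u ≫ F.map x y) (v ≫ F.map y z) := by
  simp [compE, tensorHom_comp_tensorHom_assoc]
end Map

section TensorPrePost
variable {J : Type k} [EnrichedCategory V J] {C : Type k'} [EnrichedCategory V C]
lemma tensor_comp_assoc {X Y Z : V} {x y z t : C} (a : X ⟶ EnrichedCategory.Hom x y)
    (b : Y ⟶ EnrichedCategory.Hom y z) (c : Z ⟶ EnrichedCategory.Hom z t) :
    (((a ⊗ₘ b) ≫ eComp V x y z) ⊗ₘ c) ≫ eComp V x z t =
      (α_ X Y Z).hom ≫ (a ⊗ₘ ((b ⊗ₘ c) ≫ eComp V y z t)) ≫ eComp V x y t := by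
  rw [← MonoidalCategory.tensorHom_comp_whiskerRight_assoc,
    ← MonoidalCategory.tensorHom_comp_whiskerLeft_assoc, ← e_assoc' V x y z t,
    MonoidalCategory.associator_naturality_assoc]

lemma id_tensor_comp {X : V} {x y : C} (a : X ⟶ EnrichedCategory.Hom x y) :
    (eId V x ⊗ₘ a) ≫ eComp V x x y = (λ_ X).hom ≫ a := by
  rw [← Iso.inv_comp_eq, MonoidalCategory.tensorHom_def'_assoc,
    ← leftUnitor_inv_naturality_assoc, e_id_comp, Category.comp_id]

lemma tensor_id_comp {X : V} {x y : C} (a : X ⟶ EnrichedCategory.Hom x y) :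
    (a ⊗ₘ eId V y) ≫ eComp V x y y = (ρ_ X).hom ≫ a := by
  rw [← Iso.inv_comp_eq, MonoidalCategory.tensorHom_def_assoc,
    ← rightUnitor_inv_naturality_assoc, e_comp_id, Category.comp_id]

lemma tensor_preC {X Y : V} {x y z t : C} (a : X ⟶ EnrichedCategory.Hom x y)
    (b : Y ⟶ EnrichedCategory.Hom z t) (u : 𝟙_ V ⟶ EnrichedCategory.Hom y z) :
    (a ⊗ₘ (b ≫ preC u t)) ≫ eComp V x y t = ((a ≫ postC x u) ⊗ₘ b) ≫ eComp V x z t := by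
  rw [MonoidalCategory.tensorHom_def'_assoc, MonoidalCategory.tensorHom_def'_assoc]
  simp only [MonoidalCategory.whiskerLeft_comp, comp_whiskerRight, Category.assoc,
    postC_comp_preC, ← whisker_exchange_assoc]

lemma tensor_preC' {X Y : V} {x y z t : C} (a : X ⟶ EnrichedCategory.Hom y z)
    (b : Y ⟶ EnrichedCategory.Hom z t) (u : 𝟙_ V ⟶ EnrichedCategory.Hom x y) :
    ((a ≫ preC u z) ⊗ₘ b) ≫ eComp V x z t = (a ⊗ₘ b) ≫ eComp V y z t ≫ preC u t := by
  rw [MonoidalCategory.tensorHom_def'_assoc, MonoidalCategory.tensorHom_def'_assoc, comp_preC]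
  simp only [comp_whiskerRight, Category.assoc]

lemma tensor_postC {X Y : V} {x y z t : C} (a : X ⟶ EnrichedCategory.Hom x y)
    (b : Y ⟶ EnrichedCategory.Hom y z) (u : 𝟙_ V ⟶ EnrichedCategory.Hom z t) :
    (a ⊗ₘ (b ≫ postC y u)) ≫ eComp V x y t = (a ⊗ₘ b) ≫ eComp V x y z ≫ postC x u := by
  rw [MonoidalCategory.tensorHom_def_assoc, MonoidalCategory.tensorHom_def_assoc, comp_postC]
  simp only [MonoidalCategory.whiskerLeft_comp, Category.assoc]

lemma map_conj_left (F : EnrichedFunctor V J C) {r r' j j' : J}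
    (u : 𝟙_ V ⟶ EnrichedCategory.Hom r j) (v : 𝟙_ V ⟶ EnrichedCategory.Hom j r)
    (v' : 𝟙_ V ⟶ EnrichedCategory.Hom j' r') (h : compE v u = eId V j) :
    F.map j j' ≫ postC _ (v' ≫ F.map j' r') =
      (preC u j' ≫ postC r v') ≫ F.map r r' ≫ preC (v ≫ F.map j r) _ := by
  rw [← postC_map, ← preC_map, Category.assoc, ← reassoc_of% pre_post v, reassoc_of% preC_preC, h,
    preC_id, Category.id_comp]

lemma map_conj_right (F : EnrichedFunctor V J C) {r r' j j' : J}
    (u : 𝟙_ V ⟶ EnrichedCategory.Hom r j) (u' : 𝟙_ V ⟶ EnrichedCategory.Hom r' j')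
    (v' : 𝟙_ V ⟶ EnrichedCategory.Hom j' r') (h : compE v' u' = eId V j') :
    F.map j j' ≫ preC (u ≫ F.map r j) _ =
      (preC u j' ≫ postC r v') ≫ F.map r r' ≫ postC _ (u' ≫ F.map r' j') := by
  rw [← postC_map, ← preC_map, Category.assoc, reassoc_of% postC_postC, h,
    postC_id, Category.id_comp]

end TensorPrePost

section NatTrans
variable [SymmetricCategory V]
variable {J : Type k} [EnrichedCategory V J] {C : Type k'} [EnrichedCategory V C]

/-- A V-natural transformation from `F` to `G` with parameter object `X`: a family
`X → C(F j, G j)` for which the two composites `X ⊗ J(i, j) → C(F i, G j)` agree.  For `X = 𝟙_ V`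
these are the V-natural transformations `F → G`; in general they are the morphisms from `X` to the
object `[J, C](F, G)` whenever the latter exists.  (This is Mathlib's `GradedNatTrans` for the
half-braiding on `X` given by the symmetry of `V`, without the detour through the centre.) -/
@[ext]
structure VNat (X : V) (F G : EnrichedFunctor V J C) where
  app (j : J) : X ⟶ EnrichedCategory.Hom (F.obj j) (G.obj j)
  naturality (i j : J) :
    (β_ X (EnrichedCategory.Hom i j : V)).hom ≫ (F.map i j ⊗ₘ app j) ≫ eComp V _ _ _ =
      (app i ⊗ₘ G.map i j) ≫ eComp V _ _ _

/-- Change of parameter object along `f : Y ⟶ X`. -/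
def VNat.reindex {X Y : V} {F G : EnrichedFunctor V J C} (f : Y ⟶ X) (σ : VNat X F G) :
    VNat Y F G where
  app j := f ≫ σ.app j
  naturality i j := by
    have h := f ▷ (EnrichedCategory.Hom i j : V) ≫= σ.naturality i j
    rw [BraidedCategory.braiding_naturality_left_assoc] at h
    rw [← MonoidalCategory.whiskerLeft_comp_tensorHom_assoc,
      ← MonoidalCategory.whiskerRight_comp_tensorHom_assoc]
    exact h

lemma VNat.nat_elt {X : V} {F G : EnrichedFunctor V J C} (σ : VNat X F G) {i j : J}
    (u : 𝟙_ V ⟶ EnrichedCategory.Hom i j) :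
    σ.app i ≫ postC _ (u ≫ G.map i j) = σ.app j ≫ preC (u ≫ F.map i j) _ := by
  have h := (ρ_ X).inv ≫= X ◁ u ≫= σ.naturality i j
  rw [BraidedCategory.braiding_naturality_right_assoc] at h
  simp only [preC, postC, MonoidalCategory.whiskerLeft_comp, comp_whiskerRight]
  simp only [MonoidalCategory.tensorHom_def] at h
  rw [rightUnitor_inv_naturality_assoc, leftUnitor_inv_naturality_assoc]
  simp only [Category.assoc, braiding_tensorUnit_right, Iso.inv_hom_id_assoc] at h
  rw [← whisker_exchange_assoc, ← whisker_exchange_assoc,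
    whisker_exchange_assoc (σ.app i) u] at h
  simpa only [Category.assoc] using h.symm

/-- `E` with the family `π : E → C(F j, G j)` is the end `∫_j C(F j, G j)`, that is, the object
`[J, C](F, G)` of V-natural transformations from `F` to `G`. -/
def IsHomObject {F G : EnrichedFunctor V J C} {E : V} (π : VNat E F G) : Prop :=
  ∀ (X : V) (σ : VNat X F G), ∃! f : X ⟶ E, ∀ j, f ≫ π.app j = σ.app j

lemma nat_transport {X : V} {F G : EnrichedFunctor V J C} {r r' j j' : J}
    (u : 𝟙_ V ⟶ EnrichedCategory.Hom r j) (v : 𝟙_ V ⟶ EnrichedCategory.Hom j r)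
    (u' : 𝟙_ V ⟶ EnrichedCategory.Hom r' j') (v' : 𝟙_ V ⟶ EnrichedCategory.Hom j' r')
    (h : compE v u = eId V j) (h' : compE v' u' = eId V j')
    (a : X ⟶ EnrichedCategory.Hom (F.obj r) (G.obj r))
    (a' : X ⟶ EnrichedCategory.Hom (F.obj r') (G.obj r'))
    (hn : (β_ X (EnrichedCategory.Hom r r' : V)).hom ≫ (F.map r r' ⊗ₘ a') ≫ eComp V _ _ _ =
      (a ⊗ₘ G.map r r') ≫ eComp V _ _ _) :
    (β_ X (EnrichedCategory.Hom j j' : V)).hom ≫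
      (F.map j j' ⊗ₘ (a' ≫ preC (v' ≫ F.map _ _) _ ≫ postC _ (u' ≫ G.map _ _))) ≫
        eComp V _ _ _ =
      ((a ≫ preC (v ≫ F.map _ _) _ ≫ postC _ (u ≫ G.map _ _)) ⊗ₘ G.map j j') ≫
        eComp V _ _ _ := by
  have e1 : (β_ X (EnrichedCategory.Hom j j' : V)).hom ≫
      (F.map j j' ⊗ₘ (a' ≫ preC (v' ≫ F.map _ _) _ ≫ postC _ (u' ≫ G.map _ _))) ≫
        eComp V _ _ _ = X ◁ (preC u j' ≫ postC r v') ≫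
        ((a ⊗ₘ G.map r r') ≫ eComp V _ _ _) ≫
          preC (v ≫ F.map _ _) _ ≫ postC _ (u' ≫ G.map _ _) := by
    rw [← hn, ← Category.assoc a', tensor_postC, reassoc_of% tensor_preC,
      map_conj_left F u v v' h, ← Category.assoc (preC u j' ≫ postC r v'),
      reassoc_of% tensor_preC', ← MonoidalCategory.whiskerRight_comp_tensorHom_assoc]
    simp only [Category.assoc, ← BraidedCategory.braiding_naturality_right_assoc]
  have e2 : ((a ≫ preC (v ≫ F.map _ _) _ ≫ postC _ (u ≫ G.map _ _)) ⊗ₘ G.map j j') ≫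
        eComp V _ _ _ = X ◁ (preC u j' ≫ postC r v') ≫
        ((a ⊗ₘ G.map r r') ≫ eComp V _ _ _) ≫
          preC (v ≫ F.map _ _) _ ≫ postC _ (u' ≫ G.map _ _) := by
    rw [← Category.assoc a, ← tensor_preC, map_conj_right G u u' v' h', tensor_preC',
      ← Category.assoc (preC u j' ≫ postC r v'), reassoc_of% tensor_postC,
      ← MonoidalCategory.whiskerLeft_comp_tensorHom_assoc, ← pre_post]
    simp only [Category.assoc]
  rw [e1, e2]

lemma exists_homObject_aux [MonoidalClosed V] [HasLimits V] {I : Type w} (r : I → J) (ρ : J → I)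
    (hρ : ∀ i, ρ (r i) = i)
    (u : ∀ j, 𝟙_ V ⟶ EnrichedCategory.Hom (r (ρ j)) j)
    (v : ∀ j, 𝟙_ V ⟶ EnrichedCategory.Hom j (r (ρ j)))
    (huv : ∀ j, compE (u j) (v j) = eId V _) (hvu : ∀ j, compE (v j) (u j) = eId V _)
    (F G : EnrichedFunctor V J C) : ∃ (E : V) (π : VNat E F G), IsHomObject π := by
  let S : MulticospanIndex { L := I, R := I × I, fst := Prod.fst, snd := Prod.snd } V :=
    { left i := EnrichedCategory.Hom (F.obj (r i)) (G.obj (r i))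
      right p := (ihom (EnrichedCategory.Hom (r p.1) (r p.2) : V)).obj
        (EnrichedCategory.Hom (F.obj (r p.1)) (G.obj (r p.2)))
      fst p := curry ((β_ _ _).inv ≫ _ ◁ G.map (r p.1) (r p.2) ≫ eComp V _ _ _)
      snd p := curry (F.map (r p.1) (r p.2) ▷ _ ≫ eComp V _ _ _) }
  have key {X : V} (a : ∀ i, X ⟶ S.left i) (i i' : I) :
      a i ≫ S.fst (i, i') = a i' ≫ S.snd (i, i') ↔
      (β_ X (EnrichedCategory.Hom (r i) (r i') : V)).hom ≫
        (F.map (r i) (r i') ⊗ₘ a i') ≫ eComp V _ _ _ =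
      (a i ⊗ₘ G.map (r i) (r i')) ≫ eComp V _ _ _ := by
    dsimp only [S]
    rw [← curry_natural_left, ← curry_natural_left, Function.Injective.eq_iff curry_injective,
      BraidedCategory.braiding_inv_naturality_right_assoc, Iso.inv_comp_eq,
      MonoidalCategory.tensorHom_def'_assoc, MonoidalCategory.tensorHom_def_assoc, eq_comm]
  let E : V := multiequalizer S
  let p (i : I) : E ⟶ S.left i := Multiequalizer.ι S i
  have hp (i i' : I) := (key p i i').1 (Multiequalizer.condition S (i, i'))
  let π : VNat E F G :=
    { app j := p (ρ j) ≫ preC (v j ≫ F.map _ _) _ ≫ postC _ (u j ≫ G.map _ _)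
      naturality j j' := nat_transport (u j) (v j) (u j') (v j') (hvu j) (hvu j') _ _ (hp _ _) }
  refine ⟨E, π, fun X σ => ?_⟩
  have ext1 {i j : J} (s : 𝟙_ V ⟶ EnrichedCategory.Hom i j)
      (t : 𝟙_ V ⟶ EnrichedCategory.Hom j i) (hst : compE s t = eId V _) :
      preC (t ≫ F.map _ _) (G.obj i) ≫ postC _ (s ≫ G.map _ _) ≫
        preC (s ≫ F.map _ _) _ ≫ postC _ (t ≫ G.map _ _) = 𝟙 _ := by
    rw [← reassoc_of% pre_post, postC_postC, ← compE_map, hst, EnrichedFunctor.map_id, postC_id,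
      Category.comp_id, preC_preC, ← compE_map, hst, EnrichedFunctor.map_id, preC_id]
  refine ⟨Multiequalizer.lift S X (fun i => σ.app (r i))
    (fun q => (key (fun i => σ.app (r i)) q.1 q.2).2 (σ.naturality _ _)), fun j => ?_, fun f hf => ?_⟩
  · dsimp only [π, p]
    rw [Multiequalizer.lift_ι_assoc, pre_post, reassoc_of% (σ.nat_elt (u j)), preC_preC,
      ← compE_map, hvu, EnrichedFunctor.map_id, preC_id, Category.comp_id]
  · refine Multiequalizer.hom_ext S _ _ fun i => ?_
    rw [Multiequalizer.lift_ι]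
    obtain ⟨j, rfl⟩ : ∃ j, ρ j = i := ⟨r i, hρ i⟩
    have h := (hf j =≫ preC (u j ≫ F.map _ _) _) =≫ postC _ (v j ≫ G.map _ _)
    dsimp only [π, p] at h
    simp only [Category.assoc, ext1 _ _ (huv j)] at h
    erw [Category.comp_id] at h
    rw [h, ← reassoc_of% (σ.nat_elt (u j)), postC_postC, ← compE_map, huv,
      EnrichedFunctor.map_id, postC_id, Category.comp_id]

end NatTrans

section Small
variable (V)
/-- A V-category is small when its isomorphism classes of objects form a small set, isomorphism
being that of the underlying ordinary category. Here "small" is relative to the universe `w` of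
the hom-sets of `V`. -/
class IsSmallVCat (K : Type k) [EnrichedCategory V K] : Prop where
  /-- The set of isomorphism classes of objects is small. -/
  small : Small.{w} (Quotient (isIsomorphicSetoid (ForgetEnrichment V K)))

variable [SymmetricCategory V]
instance (K : Type k) [EnrichedCategory V K] [h : IsSmallVCat V K] : IsSmallVCat V Kᵒᵖ where
  small := by
    have := h.small
    let e := forgetEnrichmentOppositeEquivalence V K
    refine small_of_injective (β := Quotient (isIsomorphicSetoid (ForgetEnrichment V K)))
      (f := Quotient.lift (fun x => Quotient.mk _ (e.functor.obj x).unop) ?_) ?_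
    · rintro a b ⟨i⟩
      exact Quotient.sound ⟨(e.functor.mapIso i).unop.symm⟩
    · rintro ⟨a⟩ ⟨b⟩ hab
      obtain ⟨i⟩ := Quotient.exact hab
      exact Quotient.sound ⟨e.functor.preimageIso (i.symm.op)⟩

variable {V}
variable {J : Type k} [EnrichedCategory V J] {C : Type k'} [EnrichedCategory V C]

theorem exists_homObject [MonoidalClosed V] [HasLimits V] [hJ : IsSmallVCat V J]
    (F G : EnrichedFunctor V J C) : ∃ (E : V) (π : VNat E F G), IsHomObject π := by
  have := hJ.small
  let Q := Quotient (isIsomorphicSetoid (ForgetEnrichment V J))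
  let r (i : Shrink.{w} Q) : ForgetEnrichment V J := ((equivShrink Q).symm i).out
  let ρ (j : ForgetEnrichment V J) : Shrink.{w} Q := equivShrink Q (Quotient.mk _ j)
  have hiso (j) : IsIsomorphic (r (ρ j)) j := by
    refine Quotient.exact (s := isIsomorphicSetoid (ForgetEnrichment V J)) ?_
    simp [r, ρ]
  let e (j) : r (ρ j) ≅ j := (hiso j).some
  refine exists_homObject_aux (fun i => ForgetEnrichment.to V (r i))
    (fun j => ρ (ForgetEnrichment.of V j)) (fun i => ?_)
    (fun j => ForgetEnrichment.homTo V (e (ForgetEnrichment.of V j)).hom)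
    (fun j => ForgetEnrichment.homTo V (e (ForgetEnrichment.of V j)).inv) (fun j => ?_)
    (fun j => ?_) F G
  · simp [r, ρ]
  · have h := congrArg (ForgetEnrichment.homTo V) (e (ForgetEnrichment.of V j)).hom_inv_id
    rw [ForgetEnrichment.homTo_comp, ForgetEnrichment.homTo_id, Category.assoc] at h
    exact h
  · have h := congrArg (ForgetEnrichment.homTo V) (e (ForgetEnrichment.of V j)).inv_hom_id
    rw [ForgetEnrichment.homTo_comp, ForgetEnrichment.homTo_id, Category.assoc] at h
    exact h

end Small

section FunctorCategory
variable [SymmetricCategory V] [MonoidalClosed V] [HasLimits V]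
variable {J : Type k} [EnrichedCategory V J] [IsSmallVCat V J] {C : Type k'} [EnrichedCategory V C]

/-- The hom-object `[J, C](F, G) = ∫_j C(F j, G j)` for a small V-category `J`. -/
noncomputable def natObj (F G : EnrichedFunctor V J C) : V := (exists_homObject F G).choose

/-- The projections `[J, C](F, G) → C(F j, G j)`. -/
noncomputable def natProj (F G : EnrichedFunctor V J C) : VNat (natObj F G) F G :=
  (exists_homObject F G).choose_spec.choose

theorem isHomObject_natProj (F G : EnrichedFunctor V J C) : IsHomObject (natProj F G) :=
  (exists_homObject F G).choose_spec.choose_spec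

/-- The morphism into `[J, C](F, G)` that corresponds to a V-natural transformation with
parameter. -/
noncomputable def natLift {F G : EnrichedFunctor V J C} {X : V} (σ : VNat X F G) :
    X ⟶ natObj F G := (isHomObject_natProj F G X σ).exists.choose

lemma natLift_proj {F G : EnrichedFunctor V J C} {X : V} (σ : VNat X F G) (j : J) :
    natLift σ ≫ (natProj F G).app j = σ.app j :=
  (isHomObject_natProj F G X σ).exists.choose_spec j

lemma natObj_hom_ext {F G : EnrichedFunctor V J C} {X : V} {f g : X ⟶ natObj F G}
    (h : ∀ j, f ≫ (natProj F G).app j = g ≫ (natProj F G).app j) : f = g :=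
  (isHomObject_natProj F G X (VNat.reindex g (natProj F G))).unique h (fun _ => rfl)

/-- The identity transformation. -/
def VNat.id (F : EnrichedFunctor V J C) : VNat (𝟙_ V) F F where
  app j := eId V _
  naturality i j := by
    rw [id_tensor_comp, tensor_id_comp, braiding_tensorUnit_left]
    simp

/-- Composition of V-natural transformations with parameters. -/
def VNat.comp {X Y : V} {F G H : EnrichedFunctor V J C} (σ : VNat X F G) (τ : VNat Y G H) :
    VNat (X ⊗ Y) F H where
  app j := (σ.app j ⊗ₘ τ.app j) ≫ eComp V _ _ _
  naturality i j := by
    rw [tensor_comp_assoc, ← τ.naturality i j, BraidedCategory.braiding_tensor_left_hom]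
    have h := tensor_comp_assoc (F.map i j) (σ.app j) (τ.app j)
    rw [← Iso.inv_comp_eq] at h
    have h' : ((β_ X (EnrichedCategory.Hom i j : V)).hom ▷ Y) ≫
        (((F.map i j ⊗ₘ σ.app j) ≫ eComp V _ _ _) ⊗ₘ τ.app j) ≫ eComp V _ _ _ =
        (((σ.app i ⊗ₘ G.map i j) ≫ eComp V _ _ _) ⊗ₘ τ.app j) ≫ eComp V _ _ _ := by
      rw [MonoidalCategory.whiskerRight_comp_tensorHom_assoc, σ.naturality i j]
    simp only [Category.assoc]
    rw [← h, Iso.hom_inv_id_assoc, h', tensor_comp_assoc]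
    simp only [← MonoidalCategory.whiskerLeft_comp_tensorHom_assoc, Iso.inv_hom_id_assoc]

/-- The functor V-category `[J, C]` for a small V-category `J`: its objects are the V-functors
`J → C`, and its hom-objects are the ends `∫_j C(F j, G j)`. -/
noncomputable instance functorVCat : EnrichedCategory V (EnrichedFunctor V J C) where
  Hom F G := natObj F G
  id F := natLift (VNat.id F)
  comp F G H := natLift (VNat.comp (natProj F G) (natProj G H))
  id_comp F G := natObj_hom_ext fun j => by
    simp only [Category.assoc, natLift_proj, VNat.comp,
      MonoidalCategory.whiskerRight_comp_tensorHom_assoc]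
    simp only [VNat.id, id_tensor_comp, Iso.inv_hom_id_assoc, Category.id_comp]
  comp_id F G := natObj_hom_ext fun j => by
    simp only [Category.assoc, natLift_proj, VNat.comp,
      MonoidalCategory.whiskerLeft_comp_tensorHom_assoc]
    simp only [VNat.id, tensor_id_comp, Iso.inv_hom_id_assoc, Category.id_comp]
  assoc F G H K := natObj_hom_ext fun j => by
    simp only [Category.assoc, natLift_proj, VNat.comp,
      MonoidalCategory.whiskerLeft_comp_tensorHom_assoc,
      MonoidalCategory.whiskerRight_comp_tensorHom_assoc]
    rw [tensor_comp_assoc, Iso.inv_hom_id_assoc]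

end FunctorCategory

section Limits
variable [MonoidalClosed V]

lemma uncurry_tensor_comp {X Y A B C : V} (f : X ⟶ (ihom A).obj B) (g : Y ⟶ (ihom B).obj C) :
    uncurry ((f ⊗ₘ g) ≫ MonoidalClosed.comp A B C) =
      (α_ A X Y).inv ≫ uncurry f ▷ Y ≫ uncurry g := by
  rw [uncurry_natural_left, MonoidalClosed.comp_eq, uncurry_curry, compTranspose_eq,
    uncurry_eq f, uncurry_eq g, MonoidalCategory.tensorHom_def]
  simp only [MonoidalCategory.whiskerLeft_comp, comp_whiskerRight, Category.assoc]
  rw [← MonoidalCategory.associator_inv_naturality_middle_assoc,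
    MonoidalCategory.associator_inv_naturality_right_assoc, whisker_exchange_assoc]
  rfl

lemma tensor_ihom_map {X Y A B C D : V} (f : X ⟶ (ihom A).obj B) (g : Y ⟶ (ihom B).obj C)
    (h : C ⟶ D) : (f ⊗ₘ (g ≫ (ihom B).map h)) ≫ MonoidalClosed.comp A B D =
      (f ⊗ₘ g) ≫ MonoidalClosed.comp A B C ≫ (ihom A).map h := by
  apply uncurry_injective
  rw [← Category.assoc (f ⊗ₘ g), uncurry_natural_right, uncurry_tensor_comp, uncurry_tensor_comp,
    uncurry_natural_right]
  simp only [Category.assoc]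

/-- The representable V-functor `C(a, -) : C → V`. -/
abbrev representable {C : Type k} [EnrichedCategory V C] (a : C) : EnrichedFunctor V C V where
  obj b := EnrichedCategory.Hom a b
  map b c := curry (eComp V a b c)
  map_id b := by
    rw [← curry_natural_left]
    change _ = curry _
    congr 1
    have := tensor_id_comp (𝟙 (EnrichedCategory.Hom a b : V))
    simpa using this
  map_comp b c d := by
    change _ = _ ≫ curry _
    rw [← curry_natural_left]
    apply uncurry_injective
    rw [uncurry_curry]
    refine Eq.trans ?_ (uncurry_tensor_comp _ _).symm
    rw [uncurry_curry, uncurry_curry, e_assoc]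

variable [SymmetricCategory V]

/-- The opposite `Fᵒᵖ : Cᵒᵖ → Dᵒᵖ` of a V-functor `F : C → D`. -/
abbrev opFunctor {C : Type k} [EnrichedCategory V C] {D : Type k'} [EnrichedCategory V D]
    (F : EnrichedFunctor V C D) : EnrichedFunctor V Cᵒᵖ Dᵒᵖ where
  obj x := Opposite.op (F.obj x.unop)
  map x y := F.map y.unop x.unop
  map_id x := F.map_id x.unop
  map_comp x y z := by
    simp only [eComp_op_eq, Category.assoc, EnrichedFunctor.map_comp]
    exact (BraidedCategory.braiding_naturality_assoc _ _ _).symm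

variable {J : Type k} [EnrichedCategory V J] {C : Type k'} [EnrichedCategory V C]
  {D : Type k''} [EnrichedCategory V D]

lemma cone_map_naturality (F : EnrichedFunctor V C D) {X I P Q : V}
    {l t t' : C}
    (f : I ⟶ (ihom P).obj Q) (s : I ⟶ EnrichedCategory.Hom t t')
    (m : X ⟶ (ihom P).obj (EnrichedCategory.Hom l t))
    (m' : X ⟶ (ihom Q).obj (EnrichedCategory.Hom l t'))
    (h : (β_ X I).hom ≫ (f ⊗ₘ m') ≫ MonoidalClosed.comp _ _ _ =
      (m ⊗ₘ (s ≫ curry (eComp V l t t'))) ≫ MonoidalClosed.comp _ _ _) :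
    (β_ X I).hom ≫ (f ⊗ₘ (m' ≫ (ihom Q).map (F.map l t'))) ≫ MonoidalClosed.comp _ _ _ =
      ((m ≫ (ihom P).map (F.map l t)) ⊗ₘ
        ((s ≫ F.map t t') ≫ curry (eComp V (F.obj l) (F.obj t) (F.obj t')))) ≫
          MonoidalClosed.comp _ _ _ := by
  rw [tensor_ihom_map, reassoc_of% h]
  apply uncurry_injective
  rw [← Category.assoc, uncurry_natural_right, uncurry_tensor_comp, uncurry_tensor_comp,
    uncurry_natural_right, uncurry_natural_left, uncurry_natural_left, uncurry_curry,
    uncurry_curry]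
  simp only [EnrichedFunctor.map_comp, MonoidalCategory.tensorHom_def, comp_whiskerRight,
    MonoidalCategory.whiskerLeft_comp, Category.assoc]
  rw [whisker_exchange_assoc]

/-- For a weight `φ : J → V` and a diagram `T : J → C`, a V-natural transformation
`φ → C(a, T -)`. -/
abbrev WeightedCone (φ : EnrichedFunctor V J V) (T : EnrichedFunctor V J C) (a : C) :=
  VNat (𝟙_ V) φ (T.comp V (representable a))

/-- The `j`-component `C(a, l) → [φ j, C(a, T j)]` of the map
`C(a, l) → [J, V](φ, C(a, T -))` induced by `μ : φ → C(l, T -)` and composition in `C`. -/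
def WeightedCone.comparison {φ : EnrichedFunctor V J V} {T : EnrichedFunctor V J C} {l : C}
    (μ : WeightedCone φ T l) (a : C) (j : J) :
    (EnrichedCategory.Hom a l : V) ⟶ (ihom (φ.obj j)).obj (EnrichedCategory.Hom a (T.obj j)) :=
  curry (uncurry' (μ.app j) ▷ _ ≫ (β_ _ _).hom ≫ eComp V a l (T.obj j))

/-- `μ : φ → C(l, T -)` is the counit of a weighted limit `l = {φ, T}`: for every `a` the induced
map `C(a, l) → [J, V](φ, C(a, T -))` is invertible, i.e. `C(a, l)` is the object of V-natural
transformations from `φ` to `C(a, T -)`. -/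
def WeightedCone.IsLimit {φ : EnrichedFunctor V J V} {T : EnrichedFunctor V J C} {l : C}
    (μ : WeightedCone φ T l) : Prop :=
  ∀ (a : C) (X : V) (σ : VNat X φ (T.comp V (representable a))),
    ∃! f : X ⟶ EnrichedCategory.Hom a l, ∀ j, f ≫ μ.comparison a j = σ.app j

/-- The image `φ → C(l, T -) → D(F l, F T -)` of `μ` under a V-functor `F : C → D`. -/
def WeightedCone.map {φ : EnrichedFunctor V J V} {T : EnrichedFunctor V J C} {l : C}
    (μ : WeightedCone φ T l) (F : EnrichedFunctor V C D) :
    WeightedCone φ (T.comp V F) (F.obj l) where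
  app j := μ.app j ≫ (ihom (φ.obj j)).map (F.map l (T.obj j))
  naturality i j := cone_map_naturality F (φ.map i j) (T.map i j) (μ.app i) (μ.app j) (μ.naturality i j)

/-- `C` admits the limit `{φ, T}` for every `T : J → C`. -/
def HasWeightedLimits (φ : EnrichedFunctor V J V) (C : Type k') [EnrichedCategory V C] : Prop :=
  ∀ T : EnrichedFunctor V J C, ∃ (l : C) (μ : WeightedCone φ T l), μ.IsLimit

/-- `F` preserves all `φ`-weighted limits that exist in its domain. -/
def PreservesWeightedLimits (φ : EnrichedFunctor V J V) (F : EnrichedFunctor V C D) : Prop :=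
  ∀ (T : EnrichedFunctor V J C) (l : C) (μ : WeightedCone φ T l), μ.IsLimit → (μ.map F).IsLimit

/-- `F : C → D` preserves all `φ`-weighted colimits that exist in its domain. The colimit `φ * S`
of `S : L → C` is the limit `{φ, Sᵒᵖ}` in `Cᵒᵖ`, and `F` preserves it when `Fᵒᵖ` preserves this
limit. -/
def PreservesWeightedColimits {L : Type k} [EnrichedCategory V L]
    (φ : EnrichedFunctor V Lᵒᵖ V) (F : EnrichedFunctor V C D) : Prop :=
  ∀ (S : EnrichedFunctor V L C) (c : C) (μ : WeightedCone φ (opFunctor S) (Opposite.op c)),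
    μ.IsLimit → (μ.map (opFunctor F)).IsLimit

end Limits

section Weights
variable (V) [SymmetricCategory V] [MonoidalClosed V]

/-- A weight: a V-functor `Kᵒᵖ → V` with `K` a small V-category. -/
structure Weight where
  /-- The small V-category `K`. -/
  K : Type k
  [cat : EnrichedCategory V K]
  [small : IsSmallVCat V K]
  /-- The V-functor `Kᵒᵖ → V`. -/
  functor : EnrichedFunctor V Kᵒᵖ V

attribute [instance] Weight.cat Weight.small

variable {V}

/-- `A` is `Φ`-complete: it admits all limits with weights in `Φ`. -/
def IsComplete (Φ : Set (Weight.{w, u, k} V)) (A : Type k') [EnrichedCategory V A] : Prop :=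
  ∀ φ ∈ Φ, HasWeightedLimits φ.functor A

/-- `F` is `Φ`-continuous: it preserves all limits with weights in `Φ`. -/
def IsContinuous (Φ : Set (Weight.{w, u, k} V)) {A : Type k'} [EnrichedCategory V A]
    {B : Type k''} [EnrichedCategory V B] (F : EnrichedFunctor V A B) : Prop :=
  ∀ φ ∈ Φ, PreservesWeightedLimits φ.functor F

/-- The saturation `Φ*` of a class `Φ` of weights: the weights `ψ` such that every `Φ`-complete
V-category is `ψ`-complete, and every `Φ`-continuous V-functor between `Φ`-complete V-categories is
`ψ`-continuous. The V-categories considered range over a universe that contains `V` and all the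
functor V-categories `[Kᵒᵖ, V]`; it may be enlarged at will through `t`. -/
def saturation (Φ : Set (Weight.{w, u, k} V)) : Set (Weight.{w, u, k} V) :=
  {ψ | (∀ (A : Type (max w u k t)) [EnrichedCategory V A],
          IsComplete Φ A → IsComplete {ψ} A) ∧
       (∀ (A B : Type (max w u k t)) [EnrichedCategory V A] [EnrichedCategory V B],
          IsComplete Φ A → IsComplete Φ B →
            ∀ F : EnrichedFunctor V A B, IsContinuous Φ F → IsContinuous {ψ} F)}

/-- A class of weights is saturated when it coincides with its saturation. -/
def IsSaturated (Φ : Set (Weight.{w, u, k} V)) : Prop :=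
  saturation.{w, u, k, t} Φ = Φ

variable [HasLimits V]

/-- The V-functor `{ψ, -} : [Kᵒᵖ, V] → V`, which is the representable functor `[Kᵒᵖ, V](ψ, -)`. -/
noncomputable def limitFunctor (ψ : Weight.{w, u, k} V) :
    EnrichedFunctor V (EnrichedFunctor V ψ.Kᵒᵖ V) V :=
  representable ψ.functor

/-- `φ`-colimits commute with `ψ`-limits in `V`: the V-functor `{ψ, -} : [Kᵒᵖ, V] → V` preserves
`φ`-colimits. -/
def CommutesWith (φ ψ : Weight.{w, u, k} V) : Prop :=
  PreservesWeightedColimits φ.functor (limitFunctor ψ)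

/-- The class `Ψ⁺` of `Ψ`-flat weights: the `φ` such that `φ`-colimits commute in `V` with
`ψ`-limits for all `ψ` in `Ψ`. -/
def flat (Ψ : Set (Weight.{w, u, k} V)) : Set (Weight.{w, u, k} V) :=
  {φ | ∀ ψ ∈ Ψ, CommutesWith φ ψ}

/-- The class `Φ⁻` of `Φ`-atomic weights: the `ψ` such that `φ`-colimits commute in `V` with
`ψ`-limits for all `φ` in `Φ`. -/
def atomic (Φ : Set (Weight.{w, u, k} V)) : Set (Weight.{w, u, k} V) :=
  {ψ | ∀ φ ∈ Φ, CommutesWith φ ψ}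

end Weights

end

end EnrichedWeights

-- The weights `φ` and `ψ : Kᵒᵖ → V` commute when the representable `[Kᵒᵖ, V](ψ, -) : [Kᵒᵖ, V] → V`
-- preserves `φ`-colimits. All four claims follow once this relation is known to be stable under
-- saturation in each variable separately.
--
-- In `φ` (`commutesWith_of_mem_saturation_left`), fix `ψ`. Both `V` and `[Kᵒᵖ, V]` have all
-- weighted colimits, the latter pointwise. If the representable of `ψ` preserves `Φ`-colimits, its
-- opposite is a `Φ`-continuous functor between `Φ`-complete categories, hence continuous for every
-- weight in `Φ*`.
--
-- In `ψ` (`commutesWith_of_mem_saturation_right`), fix `φ` and call an object `F` of `[Kᵒᵖ, V]`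
-- atomic if `[Kᵒᵖ, V](F, -)` preserves `φ`-colimits. Atomic objects form a full subcategory with
-- two properties. (1) It contains the representables: by Yoneda, homming out of one is evaluation,
-- and evaluations preserve colimits (`preservesColims_representable_yoneda`). (2) If `φ` commutes
-- with every weight in `Ψ`, it is closed under `Ψ`-colimits: for `b = ψ' * T` there is an
-- isomorphism `C(b, -) ≅ {ψ', C(T, -)}`, a composite of two functors that preserve `φ`-colimits
-- (`preservesColims_representable_colim`). By (2) the subcategory has `Ψ`-colimits and its
-- inclusion preserves them, so the same holds for every `ψ` in `Ψ*`. By (1) the Yoneda embedding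
-- lands in it. Since `ψ` is the `ψ`-weighted colimit of the Yoneda embedding (`isColim_yoneda`),
-- `ψ` is isomorphic to an atomic object and so is atomic.
--
-- Limits in `Cᵒᵖ` are treated throughout as colimits in `C`, with the weight uncurried. Copies
-- through `ULift` place every category in the universe over which saturation quantifies.

universe r r'

set_option linter.unusedSectionVars false

namespace EnrichedWeights

local notation:10 x:11 "⟹[" V "]" y:10 => EnrichedCategory.Hom (V := V) x y

variable {V : Type u} [Category.{w} V] [MonoidalCategory V] [SymmetricCategory V]
  [MonoidalClosed V]
variable {J : Type k} [EnrichedCategory V J] {C : Type k'} [EnrichedCategory V C]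
  {D : Type k''} [EnrichedCategory V D]

/-! ### Weighted colimits in uncurried form, and their agreement with limits in the opposite
category. -/

section Colimits

/-- The action `J(i, j) ⊗ φ i → φ j` of a V-functor `φ : J → V`. -/
def act (φ : EnrichedFunctor V J V) (i j : J) : (i ⟹[V] j) ⊗ φ.obj i ⟶ φ.obj j :=
  (β_ _ _).hom ≫ uncurry (φ.map i j)

/-- For a contravariant diagram `t` of shape `J` in `C`, naturality of a family
`φ j ⊗ X → C(t j, a)` in `j`. -/
def IsNat (φ : EnrichedFunctor V J V) {t : J → C} (tm : ∀ i j, (i ⟹[V] j) ⟶ (t j ⟹[V] t i))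
    {a : C} {X : V} (s : ∀ j, φ.obj j ⊗ X ⟶ (t j ⟹[V] a)) : Prop :=
  ∀ i j, (α_ _ _ _).inv ≫ act φ i j ▷ X ≫ s j = (tm i j ⊗ₘ s i) ≫ eComp V (t j) (t i) a

/-- Naturality of a family `φ j → C(t j, c)` in `j`. -/
def IsCocone (φ : EnrichedFunctor V J V) {t : J → C} (tm : ∀ i j, (i ⟹[V] j) ⟶ (t j ⟹[V] t i))
    {c : C} (m : ∀ j, φ.obj j ⟶ (t j ⟹[V] c)) : Prop :=
  ∀ i j, act φ i j ≫ m j = (tm i j ⊗ₘ m i) ≫ eComp V (t j) (t i) c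

/-- The universal property of the `φ`-weighted colimit of a contravariant diagram. -/
def IsColim (φ : EnrichedFunctor V J V) {t : J → C} (tm : ∀ i j, (i ⟹[V] j) ⟶ (t j ⟹[V] t i))
    {c : C} (m : ∀ j, φ.obj j ⟶ (t j ⟹[V] c)) : Prop :=
  ∀ (a : C) (X : V) (s : ∀ j, φ.obj j ⊗ X ⟶ (t j ⟹[V] a)), IsNat φ tm s →
    ∃! f : X ⟶ (c ⟹[V] a), ∀ j, (m j ⊗ₘ f) ≫ eComp V (t j) c a = s j

/-- The tensor-hom transpose of the naturality square of a `VNat` into `Cᵒᵖ(a, T -)`. The braiding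
before `eComp` on the left is composition in `Cᵒᵖ`. -/
lemma natural_iff_uncurry {A A' X H : V} {x x' a : C} (f : H ⟶ (ihom A).obj A')
    (g : H ⟶ (x' ⟹[V] x)) (σ : X ⟶ (ihom A).obj (x ⟹[V] a))
    (σ' : X ⟶ (ihom A').obj (x' ⟹[V] a)) :
    (β_ X H).hom ≫ (f ⊗ₘ σ') ≫ MonoidalClosed.comp A A' (x' ⟹[V] a) =
      (σ ⊗ₘ (g ≫ curry ((β_ (x ⟹[V] a) (x' ⟹[V] x)).hom ≫ eComp V x' x a))) ≫
        MonoidalClosed.comp A (x ⟹[V] a) (x' ⟹[V] a) ↔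
    (α_ H A X).inv ≫ ((β_ H A).hom ≫ uncurry f) ▷ X ≫ uncurry σ' =
      (g ⊗ₘ uncurry σ) ≫ eComp V x' x a := by
  rw [← Function.Injective.eq_iff uncurry_injective, uncurry_natural_left, uncurry_tensor_comp,
    uncurry_tensor_comp, uncurry_natural_left g, uncurry_curry,
    ← MonoidalCategory.tensorHom_def_assoc, BraidedCategory.braiding_naturality_assoc,
    BraidedCategory.braiding_tensor_left_hom,
    -- The two equations have sources `A ⊗ (X ⊗ H)` and `H ⊗ (A ⊗ X)`; this is the permutation
    -- isomorphism between them.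
    ← cancel_epi (A ◁ (β_ X H).hom ≫ (α_ _ _ _).inv ≫ (β_ _ _).hom ▷ X ≫ (α_ _ _ _).hom)]
  simp only [Category.assoc, Iso.hom_inv_id_assoc, Iso.inv_hom_id_assoc, comp_whiskerRight]
  rw [← comp_whiskerRight_assoc, SymmetricCategory.symmetry, id_whiskerRight_assoc]

lemma isColim_congr {φ : EnrichedFunctor V J V} {t : J → C}
    {tm tm' : ∀ i j, (i ⟹[V] j) ⟶ (t j ⟹[V] t i)} {c : C}
    {m m' : ∀ j, φ.obj j ⟶ (t j ⟹[V] c)} (h : ∀ i j, tm i j = tm' i j) (h' : ∀ j, m j = m' j) :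
    IsColim φ tm m ↔ IsColim φ tm' m' := by
  obtain rfl : tm = tm' := funext fun i => funext (h i)
  obtain rfl : m = m' := funext h'
  rfl

lemma vnat_iff_isNat {φ : EnrichedFunctor V J V} (T : EnrichedFunctor V J Cᵒᵖ) {a : C} {X : V}
    (σ : ∀ j, X ⟶ (ihom (φ.obj j)).obj ((T.obj j).unop ⟹[V] a)) :
    (∀ i j, (β_ X (i ⟹[V] j)).hom ≫ (φ.map i j ⊗ₘ σ j) ≫ MonoidalClosed.comp _ _ _ =
      (σ i ⊗ₘ (T.comp V (representable (Opposite.op a))).map i j) ≫ MonoidalClosed.comp _ _ _) ↔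
    IsNat φ (t := fun j => (T.obj j).unop) T.map (fun j => uncurry (σ j)) :=
  forall_congr' fun i => forall_congr' fun j =>
    natural_iff_uncurry (x := (T.obj i).unop) (x' := (T.obj j).unop) (a := a) (φ.map i j)
      (T.map i j) (σ i) (σ j)

/-- One braiding comes from the comparison map and one from composition in `Cᵒᵖ`; by symmetry they
cancel. -/
lemma uncurry_comparison {A X : V} {x c a : C} (μ : 𝟙_ V ⟶ (ihom A).obj (x ⟹[V] c))
    (f : X ⟶ (c ⟹[V] a)) :
    uncurry (f ≫ curry (uncurry' μ ▷ _ ≫ (β_ _ _).hom ≫ (β_ _ _).hom ≫ eComp V x c a)) =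
      (uncurry' μ ⊗ₘ f) ≫ eComp V x c a := by
  rw [uncurry_natural_left, uncurry_curry, MonoidalCategory.tensorHom_def']
  simp

lemma isCocone_iff_isNat {φ : EnrichedFunctor V J V} {t : J → C}
    {tm : ∀ i j, (i ⟹[V] j) ⟶ (t j ⟹[V] t i)} {c : C} (m : ∀ j, φ.obj j ⟶ (t j ⟹[V] c)) :
    IsCocone φ tm m ↔ IsNat φ tm (fun j => (ρ_ _).hom ≫ m j) := by
  refine forall_congr' fun i => forall_congr' fun j => ?_
  rw [← cancel_epi ((i ⟹[V] j) ◁ (ρ_ (φ.obj i)).hom),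
    MonoidalCategory.whiskerLeft_comp_tensorHom_assoc]
  simp

/-- The cone in `Cᵒᵖ` given by a cocone in `C`. -/
def coneOf {φ : EnrichedFunctor V J V} (T : EnrichedFunctor V J Cᵒᵖ) {c : C}
    (m : ∀ j, φ.obj j ⟶ ((T.obj j).unop ⟹[V] c)) (hm : IsCocone φ T.map m) :
    WeightedCone φ T (Opposite.op c) where
  app j := curry' (m j)
  naturality := (vnat_iff_isNat T _).2 (by
    have h : (fun j => (ρ_ _).hom ≫ m j) = fun j => uncurry (curry' (m j)) :=
      funext fun j => (uncurry_curry _).symm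
    exact h ▸ (isCocone_iff_isNat m).1 hm)

lemma isCocone_cone {φ : EnrichedFunctor V J V} {T : EnrichedFunctor V J Cᵒᵖ} {c : C}
    (μ : WeightedCone φ T (Opposite.op c)) :
    IsCocone φ (t := fun j => (T.obj j).unop) (c := c) T.map (fun j => uncurry' (μ.app j)) := by
  rw [isCocone_iff_isNat]
  convert (vnat_iff_isNat T _).1 μ.naturality using 2
  simp [uncurry']

lemma isLimit_iff_isColim {φ : EnrichedFunctor V J V} {T : EnrichedFunctor V J Cᵒᵖ} {c : C}
    (μ : WeightedCone φ T (Opposite.op c)) :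
    μ.IsLimit ↔
      IsColim φ (t := fun j => (T.obj j).unop) (c := c) T.map (fun j => uncurry' (μ.app j)) := by
  have key {a : C} {X : V} (f : X ⟶ (c ⟹[V] a)) (j : J)
      (σ : X ⟶ (ihom (φ.obj j)).obj ((T.obj j).unop ⟹[V] a)) :
      f ≫ μ.comparison (Opposite.op a) j = σ ↔
        (uncurry' (μ.app j) ⊗ₘ f) ≫ eComp V (T.obj j).unop c a = uncurry σ := by
    rw [← Function.Injective.eq_iff uncurry_injective]
    exact Eq.congr_left (uncurry_comparison (x := (T.obj j).unop) (c := c) (a := a) (μ.app j) f)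
  constructor
  · intro h a X s hs
    have hs' : (fun j => uncurry (curry (s j))) = s := funext fun j => uncurry_curry _
    obtain ⟨f, hf, hu⟩ := h (Opposite.op a) X
      ⟨fun j => curry (s j), (vnat_iff_isNat T _).2 (hs'.symm ▸ hs)⟩
    refine ⟨f, fun j => ?_, fun g hg => hu g fun j => ?_⟩
    · exact ((key f j (curry (s j))).1 (hf j)).trans (uncurry_curry _)
    · exact (key g j (curry (s j))).2 ((hg j).trans (uncurry_curry _).symm)
  · intro h a X σ
    obtain ⟨f, hf, hu⟩ := h a.unop X (fun j => uncurry (σ.app j))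
      ((vnat_iff_isNat T _).1 σ.naturality)
    refine ⟨f, fun j => ?_, fun g hg => hu g fun j => ?_⟩
    · exact (key f j (σ.app j)).2 (hf j)
    · exact (key g j (σ.app j)).1 (hg j)

lemma isLimit_coneOf {φ : EnrichedFunctor V J V} {T : EnrichedFunctor V J Cᵒᵖ} {c : C}
    {m : ∀ j, φ.obj j ⟶ ((T.obj j).unop ⟹[V] c)} {hm : IsCocone φ T.map m} :
    (coneOf T m hm).IsLimit ↔ IsColim φ (t := fun j => (T.obj j).unop) T.map m := 
  (isLimit_iff_isColim _).trans
    (isColim_congr (fun _ _ => rfl) fun j => uncurry'_curry' (m j))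

lemma uncurry'_comp_map {A B B' : V} (f : 𝟙_ V ⟶ (ihom A).obj B) (g : B ⟶ B') :
    uncurry' (f ≫ (ihom A).map g) = uncurry' f ≫ g := by
  simp [uncurry', uncurry_natural_right]

lemma isLimit_map_iff {φ : EnrichedFunctor V J V} {T : EnrichedFunctor V J Cᵒᵖ} {c : C}
    (μ : WeightedCone φ T (Opposite.op c)) (F : EnrichedFunctor V C D) :
    (μ.map (opFunctor F)).IsLimit ↔ IsColim φ (t := fun j => F.obj (T.obj j).unop)
      (c := F.obj c) (fun i j => T.map i j ≫ F.map _ _)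
      (fun j => uncurry' (μ.app j) ≫ F.map _ _) := 
  (isLimit_iff_isColim (φ := φ) (T := T.comp V (opFunctor F)) (μ.map (opFunctor F))).trans
    (isColim_congr (fun _ _ => rfl) fun j => uncurry'_comp_map (μ.app j) (F.map (T.obj j).unop c))

/-- `C` has all `φ`-weighted colimits, for diagrams of shape `Jᵒᵖ`. -/
def HasColims (φ : EnrichedFunctor V J V) (C : Type k') [EnrichedCategory V C] : Prop :=
  ∀ T : EnrichedFunctor V J Cᵒᵖ, ∃ (c : C) (m : ∀ j, φ.obj j ⟶ ((T.obj j).unop ⟹[V] c)),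
    IsCocone φ (t := fun j => (T.obj j).unop) T.map m ∧
    IsColim φ (t := fun j => (T.obj j).unop) T.map m

/-- `F` preserves all `φ`-weighted colimits that exist in its domain. -/
def PreservesColims (φ : EnrichedFunctor V J V) (F : EnrichedFunctor V C D) : Prop :=
  ∀ (T : EnrichedFunctor V J Cᵒᵖ) (c : C) (m : ∀ j, φ.obj j ⟶ ((T.obj j).unop ⟹[V] c)),
    IsCocone φ (t := fun j => (T.obj j).unop) T.map m →
    IsColim φ (t := fun j => (T.obj j).unop) T.map m →
    IsColim φ (t := fun j => F.obj (T.obj j).unop) (c := F.obj c)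
      (fun i j => T.map i j ≫ F.map _ _) (fun j => m j ≫ F.map _ _)

lemma hasWeightedLimits_op_iff (φ : EnrichedFunctor V J V) :
    HasWeightedLimits φ Cᵒᵖ ↔ HasColims φ C := by
  refine forall_congr' fun T => ⟨?_, ?_⟩
  · rintro ⟨c, μ, hμ⟩
    exact ⟨c.unop, _, isCocone_cone (c := c.unop) μ, (isLimit_iff_isColim (c := c.unop) μ).1 hμ⟩
  · rintro ⟨c, m, hm, hm'⟩
    exact ⟨Opposite.op c, coneOf T m hm, isLimit_coneOf.2 hm'⟩

lemma preservesWeightedLimits_opFunctor_iff (φ : EnrichedFunctor V J V)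
    (F : EnrichedFunctor V C D) :
    PreservesWeightedLimits φ (opFunctor F) ↔ PreservesColims φ F := by
  constructor
  · intro h T c m hm hm'
    exact (isColim_congr (fun _ _ => rfl)
      fun j => congrArg (· ≫ F.map (T.obj j).unop c) (uncurry'_curry' (m j))).1
        ((isLimit_map_iff (coneOf T m hm) F).1 (h T _ _ (isLimit_coneOf.2 hm')))
  · intro h T c μ hμ
    exact (isLimit_map_iff (c := c.unop) μ F).2
      (h T c.unop _ (isCocone_cone (c := c.unop) μ) ((isLimit_iff_isColim (c := c.unop) μ).1 hμ))

lemma map_comp_unop (T : EnrichedFunctor V J Cᵒᵖ) (i j l : J) :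
    eComp V i j l ≫ T.map i l = (β_ _ _).hom ≫
      ((T.map j l : (j ⟹[V] l) ⟶ ((T.obj l).unop ⟹[V] (T.obj j).unop)) ⊗ₘ
        (T.map i j : (i ⟹[V] j) ⟶ ((T.obj j).unop ⟹[V] (T.obj i).unop))) ≫
      eComp V (T.obj l).unop (T.obj j).unop (T.obj i).unop :=
  (T.map_comp i j l).trans
    (BraidedCategory.braiding_naturality_assoc
      (T.map i j : (i ⟹[V] j) ⟶ ((T.obj j).unop ⟹[V] (T.obj i).unop))
      (T.map j l : (j ⟹[V] l) ⟶ ((T.obj l).unop ⟹[V] (T.obj j).unop)) _)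

/-- The left side tests only diagrams of the form `opFunctor S`. Every V-functor `Lᵒᵖ → Cᵒᵖ` has
this form; the composition law for `S` is obtained by cancelling a braiding. -/
lemma preservesWeightedColimits_iff {L : Type k} [EnrichedCategory V L]
    (φ : EnrichedFunctor V Lᵒᵖ V) (F : EnrichedFunctor V C D) :
    PreservesWeightedColimits φ F ↔ PreservesColims φ F := by
  rw [← preservesWeightedLimits_opFunctor_iff]
  refine ⟨fun h T c μ hμ => ?_, fun h S c μ hμ => h _ _ μ hμ⟩
  let S : EnrichedFunctor V L C :=
    { obj x := (T.obj (Opposite.op x)).unop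
      map x y := T.map (Opposite.op y) (Opposite.op x)
      map_id x := T.map_id (Opposite.op x)
      map_comp x y z := by
        refine (cancel_epi (β_ (y ⟹[V] z) (x ⟹[V] y)).hom).1 ?_
        have h := map_comp_unop T (Opposite.op z) (Opposite.op y) (Opposite.op x)
        rw [eComp_op_eq, Category.assoc] at h
        exact h }
  exact h S c.unop μ hμ

end Colimits

/-! ### Uniqueness of colimits and invariance under isomorphism. -/

section Transfer
variable {φ : EnrichedFunctor V J V} {t : J → C} {tm : ∀ i j, (i ⟹[V] j) ⟶ (t j ⟹[V] t i)} {c : C}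
  {m : ∀ j, φ.obj j ⟶ (t j ⟹[V] c)}

lemma IsCocone.isNat_comp (hm : IsCocone φ tm m) {a : C} {X : V} (f : X ⟶ (c ⟹[V] a)) :
    IsNat φ tm (fun j => (m j ⊗ₘ f) ≫ eComp V (t j) c a) := by
  intro i j
  have h := tensor_comp_assoc (tm i j) (m i) f
  rw [MonoidalCategory.whiskerRight_comp_tensorHom_assoc, hm i j, h, Iso.inv_hom_id_assoc]

lemma IsNat.map {a : C} {X : V} {s : ∀ j, φ.obj j ⊗ X ⟶ (t j ⟹[V] a)} (hs : IsNat φ tm s)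
    (F : EnrichedFunctor V C D) :
    IsNat φ (t := fun j => F.obj (t j)) (a := F.obj a) (fun i j => tm i j ≫ F.map _ _)
      (fun j => s j ≫ F.map _ _) := by
  intro i j
  have h := hs i j =≫ F.map _ _
  simp only [Category.assoc, EnrichedFunctor.map_comp, tensorHom_comp_tensorHom_assoc] at h
  exact h

lemma IsCocone.map (hm : IsCocone φ tm m) (F : EnrichedFunctor V C D) :
    IsCocone φ (t := fun j => F.obj (t j)) (c := F.obj c) (fun i j => tm i j ≫ F.map _ _)
      (fun j => m j ≫ F.map _ _) := by
  intro i j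
  have h := hm i j =≫ F.map _ _
  simp only [Category.assoc, EnrichedFunctor.map_comp, tensorHom_comp_tensorHom_assoc] at h
  exact h

/-- `IsColim` does not include naturality of `m`. The hypothesis `hm` makes the family induced by
`g` natural, so that the uniqueness clause applies to it. -/
lemma IsColim.hom_ext (hc : IsColim φ tm m) (hm : IsCocone φ tm m) {a : C} {X : V}
    {f g : X ⟶ (c ⟹[V] a)}
    (h : ∀ j, (m j ⊗ₘ f) ≫ eComp V (t j) c a = (m j ⊗ₘ g) ≫ eComp V (t j) c a) : f = g :=
  (hc a X _ (hm.isNat_comp g)).unique h fun _ => rfl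

lemma IsNat.precomp {t' : J → C} {tm' : ∀ i j, (i ⟹[V] j) ⟶ (t' j ⟹[V] t' i)}
    (v : ∀ j, 𝟙_ V ⟶ (t j ⟹[V] t' j))
    (hv : ∀ i j, tm' i j ≫ preC (v j) (t' i) = tm i j ≫ postC (t j) (v i)) {a : C} {X : V}
    {s : ∀ j, φ.obj j ⊗ X ⟶ (t' j ⟹[V] a)} (hs : IsNat φ tm' s) :
    IsNat φ tm (fun j => s j ≫ preC (v j) a) := by
  intro i j
  have h := hs i j =≫ preC (v j) a
  simp only [Category.assoc] at h
  rw [h, tensor_preC, ← hv, tensor_preC']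

/-- Invariance of the universal property under an isomorphism `u`, `v` of diagrams and an
isomorphism `p`, `q` of vertices. Only the naturality of `u` has to be supplied. -/
lemma IsColim.transfer (hc : IsColim φ tm m) {t' : J → C}
    {tm' : ∀ i j, (i ⟹[V] j) ⟶ (t' j ⟹[V] t' i)} {c' : C} {m' : ∀ j, φ.obj j ⟶ (t' j ⟹[V] c')}
    (u : ∀ j, 𝟙_ V ⟶ (t' j ⟹[V] t j)) (v : ∀ j, 𝟙_ V ⟶ (t j ⟹[V] t' j))
    (huv : ∀ j, compE (u j) (v j) = eId V _) (hvu : ∀ j, compE (v j) (u j) = eId V _)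
    (hu : ∀ i j, tm i j ≫ preC (u j) (t i) = tm' i j ≫ postC (t' j) (u i))
    (p : 𝟙_ V ⟶ (c ⟹[V] c')) (q : 𝟙_ V ⟶ (c' ⟹[V] c))
    (hpq : compE p q = eId V _) (hqp : compE q p = eId V _)
    (hm : ∀ j, m j ≫ preC (u j) c ≫ postC (t' j) p = m' j) : IsColim φ tm' m' := by
  -- The inverse of a natural isomorphism is natural: compose the square for `u` with `v` on both
  -- sides.
  have hv (i j : J) : tm' i j ≫ preC (v j) (t' i) = tm i j ≫ postC (t j) (v i) := by
    have h := (hu i j =≫ postC (t' j) (v i)) =≫ preC (v j) (t' i)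
    simp only [Category.assoc, pre_post, postC_postC, huv, postC_id] at h
    rw [Category.id_comp, preC_preC, hvu, preC_id, Category.comp_id] at h
    exact h.symm
  have hcomp {a : C} {X : V} (f : X ⟶ (c' ⟹[V] a)) (j : J) :
      (m' j ⊗ₘ f) ≫ eComp V (t' j) c' a =
        (m j ⊗ₘ (f ≫ preC p a)) ≫ eComp V (t j) c a ≫ preC (u j) a := by
    rw [← hm, ← Category.assoc (m j), ← tensor_preC, tensor_preC']
  intro a X s hs
  obtain ⟨f, hf, hf'⟩ := hc a X _ (hs.precomp v hv)
  refine ⟨f ≫ preC q a, fun j => ?_, fun g hg => ?_⟩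
  · rw [hcomp, Category.assoc, preC_preC, hpq, preC_id, Category.comp_id, reassoc_of% hf j,
      preC_preC, huv, preC_id, Category.comp_id]
  · rw [← hf' (g ≫ preC p a), Category.assoc, preC_preC, hqp, preC_id, Category.comp_id]
    intro j
    rw [← hg j, hcomp, Category.assoc, Category.assoc, preC_preC, hvu, preC_id, Category.comp_id]

lemma IsColim.exists_iso (hc : IsColim φ tm m) (hm : IsCocone φ tm m) {c' : C}
    {m' : ∀ j, φ.obj j ⟶ (t j ⟹[V] c')} (hc' : IsColim φ tm m') (hm' : IsCocone φ tm m') :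
    ∃ (p : 𝟙_ V ⟶ (c ⟹[V] c')) (q : 𝟙_ V ⟶ (c' ⟹[V] c)), compE p q = eId V _ ∧
      compE q p = eId V _ ∧ ∀ j, m j ≫ postC (t j) p = m' j := by
  have post {c c' : C} (m : ∀ j, φ.obj j ⟶ (t j ⟹[V] c)) (p : 𝟙_ V ⟶ (c ⟹[V] c')) (j : J) :
      (m j ⊗ₘ p) ≫ eComp V (t j) c c' = (ρ_ _).hom ≫ m j ≫ postC (t j) p := by
    rw [postC, rightUnitor_inv_naturality_assoc, Iso.hom_inv_id_assoc,
      MonoidalCategory.tensorHom_def_assoc]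
  have main {c c' : C} {m : ∀ j, φ.obj j ⟶ (t j ⟹[V] c)} (hc : IsColim φ tm m)
      {m' : ∀ j, φ.obj j ⟶ (t j ⟹[V] c')} (hm' : IsCocone φ tm m') :
      ∃ p : 𝟙_ V ⟶ (c ⟹[V] c'), ∀ j, m j ≫ postC (t j) p = m' j := by
    -- Ordinary morphisms out of the vertex are those with parameter object `𝟙_ V`.
    obtain ⟨p, hp, -⟩ := hc c' (𝟙_ V) _ ((isCocone_iff_isNat m').1 hm')
    refine ⟨p, fun j => (cancel_epi (ρ_ (φ.obj j)).hom).1 ?_⟩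
    rw [← post, hp]
  have uniq {c c' : C} {m : ∀ j, φ.obj j ⟶ (t j ⟹[V] c)} (hc : IsColim φ tm m)
      (hm : IsCocone φ tm m) {p : 𝟙_ V ⟶ (c ⟹[V] c)} (hp : ∀ j, m j ≫ postC (t j) p = m j) :
      p = eId V c :=
    hc.hom_ext hm fun j => by rw [post, post, hp, postC_id, Category.comp_id]
  obtain ⟨p, hp⟩ := main hc hm'
  obtain ⟨q, hq⟩ := main hc' hm
  refine ⟨p, q, uniq (c' := c) hc hm fun j => ?_, uniq (c' := c) hc' hm' fun j => ?_, hp⟩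
  · rw [← postC_postC, reassoc_of% hp j, hq]
  · rw [← postC_postC, reassoc_of% hq j, hp]

/-- A functor that preserves one colimit cocone preserves all those over the same diagram. -/
lemma IsColim.map_of_map (hc : IsColim φ tm m) (hm : IsCocone φ tm m) {F : EnrichedFunctor V C D}
    (hF : IsColim φ (t := fun j => F.obj (t j)) (c := F.obj c)
      (fun i j => tm i j ≫ F.map _ _) (fun j => m j ≫ F.map _ _)) {c' : C}
    {m' : ∀ j, φ.obj j ⟶ (t j ⟹[V] c')} (hc' : IsColim φ tm m') (hm' : IsCocone φ tm m') :
    IsColim φ (t := fun j => F.obj (t j)) (c := F.obj c')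
      (fun i j => tm i j ≫ F.map _ _) (fun j => m' j ≫ F.map _ _) := by
  obtain ⟨p, q, hpq, hqp, hp⟩ := hc.exists_iso hm hc' hm'
  refine hF.transfer (fun _ => eId V _) (fun _ => eId V _) (fun _ => ?_) (fun _ => ?_)
    (fun _ _ => ?_) (p ≫ F.map _ _) (q ≫ F.map _ _) ?_ ?_ fun j => ?_
  · simp [compE, id_tensor_comp]
  · simp [compE, id_tensor_comp]
  · simp [preC_id, postC_id]
  · rw [← compE_map, hpq, EnrichedFunctor.map_id]
  · rw [← compE_map, hqp, EnrichedFunctor.map_id]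
  · rw [preC_id, Category.id_comp, Category.assoc, ← postC_map, reassoc_of% hp j]

/-- Preservation of colimits is invariant under isomorphism of functors into `V`. -/
lemma PreservesColims.of_iso {F G : EnrichedFunctor V C V} (hF : PreservesColims φ F)
    (e : ∀ a, F.obj a ≅ G.obj a) (he : ∀ a b : C, uncurry (F.map a b) ≫ (e b).hom =
      (e a).hom ▷ _ ≫ uncurry (G.map a b)) : PreservesColims φ G := by
  have hpost {A B B' : V} (g : B ⟶ B') : postC A (curry' g) = (ihom A).map g := by
    change (ρ_ _).inv ≫ _ ◁ curry' g ≫ MonoidalClosed.comp A B B' = _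
    rw [whiskerLeft_curry'_comp, Iso.inv_hom_id_assoc]
  have hpre {A A' B : V} (g : A ⟶ A') : preC (curry' g) B = (MonoidalClosed.pre g).app B := by
    change (λ_ _).inv ≫ curry' g ▷ _ ≫ MonoidalClosed.comp A A' B = _
    rw [curry'_whiskerRight_comp, Iso.inv_hom_id_assoc]
  have hcompE {A B : V} (f : A ≅ B) :
      compE (V := V) (C := V) (x := A) (y := B) (z := A) (curry' f.hom) (curry' f.inv) =
        eId V A :=
    (curry'_comp f.hom f.inv).symm.trans (by rw [f.hom_inv_id]; exact curry'_id A)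
  -- The transpose of `he`, stated for the inverses; this is the naturality that `IsColim.transfer`
  -- asks for.
  have hmap (a b : C) : F.map a b ≫ (MonoidalClosed.pre (e a).inv).app (F.obj b) =
      G.map a b ≫ (ihom (G.obj a)).map (e b).inv := by
    apply uncurry_injective
    rw [uncurry_natural_right, MonoidalClosed.uncurry_pre_app, ← cancel_mono (e b).hom]
    simp [he, ← comp_whiskerRight_assoc]
  intro T c m hm hc
  refine (hF T c m hm hc).transfer (fun j => curry' (e (T.obj j).unop).inv)
    (fun j => curry' (e (T.obj j).unop).hom) (fun j => ?_) (fun j => ?_) (fun i j => ?_)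
    (curry' (e c).hom) (curry' (e c).inv) ?_ ?_ (fun j => ?_)
  · exact hcompE (e _).symm
  · exact hcompE (e _)
  · rw [hpre, hpost, Category.assoc, Category.assoc, hmap]
  · exact hcompE (e _)
  · exact hcompE (e _).symm
  · rw [hpre, hpost, Category.assoc, reassoc_of% hmap, ← Functor.map_comp, Iso.inv_hom_id,
      CategoryTheory.Functor.map_id]
    exact congrArg (m j ≫ ·) (Category.comp_id _)

end Transfer

/-! ### Existence of small weighted colimits in `V`. -/

section Small

/-- Colimits in `V` weighted by families indexed by a small set. -/
lemma exists_colim_of_small [HasColimits V] {I : Type w} (A B : I → V) (H : I → I → V)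
    (ac : ∀ i j, H i j ⊗ A i ⟶ A j) (tm : ∀ i j, H i j ⟶ (ihom (B j)).obj (B i)) :
    ∃ (c : V) (m : ∀ i, A i ⟶ (ihom (B i)).obj c),
      (∀ i j, ac i j ≫ m j = (tm i j ⊗ₘ m i) ≫ MonoidalClosed.comp (B j) (B i) c) ∧
      ∀ (a X : V) (s : ∀ i, A i ⊗ X ⟶ (ihom (B i)).obj a),
        (∀ i j, (α_ _ _ _).inv ≫ ac i j ▷ X ≫ s j =
          (tm i j ⊗ₘ s i) ≫ MonoidalClosed.comp (B j) (B i) a) →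
        ∃! f : X ⟶ (ihom c).obj a, ∀ i, (m i ⊗ₘ f) ≫ MonoidalClosed.comp (B i) c a = s i := by
  -- The coend formula: the colimit is the coequalizer of the two maps from the sum of the `B j ⊗ (H
  -- i j ⊗ A i)` to the sum of the `B i ⊗ A i`. No category or functor axioms on `H`, `ac` and `tm`
  -- are needed.
  let S : MultispanIndex { L := I × I, R := I, fst := Prod.fst, snd := Prod.snd } V :=
    { left p := B p.2 ⊗ (H p.1 p.2 ⊗ A p.1)
      right i := B i ⊗ A i
      fst p := (α_ _ _ _).inv ≫ uncurry (tm p.1 p.2) ▷ A p.1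
      snd p := B p.2 ◁ ac p.1 p.2 }
  let c : V := multicoequalizer S
  let π (i : I) : B i ⊗ A i ⟶ c := Multicoequalizer.π S i
  have hπ (i j : I) : (α_ _ _ _).inv ≫ uncurry (tm i j) ▷ A i ≫ π i = B j ◁ ac i j ≫ π j := by
    simpa [S] using Multicoequalizer.condition S (i, j)
  have hcomp {a X : V} (f : X ⟶ (ihom c).obj a) (i : I) :
      uncurry ((curry (π i) ⊗ₘ f) ≫ MonoidalClosed.comp (B i) c a) =
        (α_ _ _ _).inv ≫ π i ▷ X ≫ uncurry f := by
    rw [uncurry_tensor_comp, uncurry_curry]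
  refine ⟨c, fun i => curry (π i), fun i j => ?_, fun a X s hs => ?_⟩
  · apply uncurry_injective
    rw [uncurry_natural_left, uncurry_curry, uncurry_tensor_comp, uncurry_curry, hπ]
  · let κ (i : I) : B i ⊗ A i ⟶ (ihom X).obj a :=
      curry ((β_ _ _).hom ≫ (α_ _ _ _).hom ≫ uncurry (s i))
    have hκ (i j : I) : ((α_ _ _ _).inv ≫ uncurry (tm i j) ▷ A i) ≫ κ i = B j ◁ ac i j ≫ κ j := by
      have h := congrArg uncurry (hs i j)
      rw [uncurry_tensor_comp, uncurry_natural_left, uncurry_natural_left] at h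
      apply uncurry_injective
      rw [uncurry_natural_left, uncurry_natural_left, uncurry_curry, uncurry_curry,
        BraidedCategory.braiding_naturality_right_assoc,
        BraidedCategory.braiding_naturality_right_assoc]
      congr 1
      have p : (α_ (B j) (H i j) (A i)).inv ▷ X ≫ (α_ _ _ _).hom =
          (α_ _ _ _).hom ≫ B j ◁ (α_ _ _ _).hom ≫ (α_ _ _ _).inv := by simp
      rw [comp_whiskerRight_assoc, MonoidalCategory.associator_naturality_left_assoc,
        reassoc_of% p, ← h, ← MonoidalCategory.whiskerLeft_comp_assoc, Iso.hom_inv_id,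
        MonoidalCategory.whiskerLeft_id, Category.id_comp,
        MonoidalCategory.associator_naturality_middle_assoc]
    refine ⟨curry ((β_ _ _).hom ≫ uncurry (Multicoequalizer.desc S _ κ fun p => hκ p.1 p.2)),
      fun i => ?_, fun g hg => ?_⟩
    · apply uncurry_injective
      rw [hcomp, uncurry_curry, BraidedCategory.braiding_naturality_left_assoc,
        ← uncurry_natural_left]
      dsimp only [π]
      rw [Multicoequalizer.π_desc, uncurry_curry, SymmetricCategory.symmetry_assoc,
        Iso.inv_hom_id_assoc]
    · have h : curry ((β_ _ _).hom ≫ uncurry g) =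
          Multicoequalizer.desc S _ κ fun p => hκ p.1 p.2 := by
        refine Multicoequalizer.hom_ext S _ _ fun i => ?_
        rw [Multicoequalizer.π_desc]
        apply uncurry_injective
        rw [uncurry_natural_left, uncurry_curry, uncurry_curry, ← hg i, hcomp,
          Iso.hom_inv_id_assoc, BraidedCategory.braiding_naturality_right_assoc]
      apply uncurry_injective
      rw [← h, uncurry_curry, uncurry_curry, SymmetricCategory.symmetry_assoc]

/-- Smallness concerns only isomorphism classes, while the coequalizer in `V` needs an index set in
`Type w`; representatives of the classes provide one. -/
lemma exists_small_skeleton (J : Type k) [EnrichedCategory V J] [hJ : IsSmallVCat V J] :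
    ∃ (I : Type w) (r : I → J) (ρ : J → I), Function.Surjective ρ ∧
      ∃ (u : ∀ j, 𝟙_ V ⟶ (r (ρ j) ⟹[V] j)) (v : ∀ j, 𝟙_ V ⟶ (j ⟹[V] r (ρ j))),
        (∀ j, compE (u j) (v j) = eId V _) ∧ ∀ j, compE (v j) (u j) = eId V _ := by
  have := hJ.small
  let Q := Quotient (isIsomorphicSetoid (ForgetEnrichment V J))
  let r (i : Shrink.{w} Q) : ForgetEnrichment V J := ((equivShrink Q).symm i).out
  let ρ (j : ForgetEnrichment V J) : Shrink.{w} Q := equivShrink Q (Quotient.mk _ j)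
  have hiso (j) : IsIsomorphic (r (ρ j)) j := by
    refine Quotient.exact (s := isIsomorphicSetoid (ForgetEnrichment V J)) ?_
    simp [r, ρ]
  let e (j) : r (ρ j) ≅ j := (hiso j).some
  refine ⟨Shrink.{w} Q, fun i => ForgetEnrichment.to V (r i),
    fun j => ρ (ForgetEnrichment.of V j), fun i => ⟨ForgetEnrichment.to V (r i), by simp [r, ρ]⟩,
    fun j => ForgetEnrichment.homTo V (e (ForgetEnrichment.of V j)).hom,
    fun j => ForgetEnrichment.homTo V (e (ForgetEnrichment.of V j)).inv, fun j => ?_, fun j => ?_⟩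
  · have h := congrArg (ForgetEnrichment.homTo V) (e (ForgetEnrichment.of V j)).hom_inv_id
    rw [ForgetEnrichment.homTo_comp, ForgetEnrichment.homTo_id, Category.assoc] at h
    exact h
  · have h := congrArg (ForgetEnrichment.homTo V) (e (ForgetEnrichment.of V j)).inv_hom_id
    rw [ForgetEnrichment.homTo_comp, ForgetEnrichment.homTo_id, Category.assoc] at h
    exact h

/-- The morphism `φ i → φ j` given by an element of `J(i, j)`. -/
def actE (φ : EnrichedFunctor V J V) {i j : J} (u : 𝟙_ V ⟶ (i ⟹[V] j)) : φ.obj i ⟶ φ.obj j :=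
  (λ_ _).inv ≫ u ▷ _ ≫ act φ i j

lemma postC_self {A B B' : V} (g : 𝟙_ V ⟶ (ihom B).obj B') :
    postC (V := V) (C := V) (y := B) (z := B') A g = (ihom A).map (uncurry' g) := by
  obtain ⟨g, rfl⟩ : ∃ g', g = curry' g' := ⟨uncurry' g, by simp⟩
  change (ρ_ _).inv ≫ _ ◁ curry' g ≫ MonoidalClosed.comp A B B' = _
  rw [whiskerLeft_curry'_comp, Iso.inv_hom_id_assoc, uncurry'_curry']

lemma preC_self {A A' B : V} (g : 𝟙_ V ⟶ (ihom A).obj A') :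
    preC (V := V) (C := V) (x := A) (y := A') g B = (MonoidalClosed.pre (uncurry' g)).app B := by
  obtain ⟨g, rfl⟩ : ∃ g', g = curry' g' := ⟨uncurry' g, by simp⟩
  change (λ_ _).inv ≫ curry' g ▷ _ ≫ MonoidalClosed.comp A A' B = _
  rw [curry'_whiskerRight_comp, Iso.inv_hom_id_assoc, uncurry'_curry']

variable (φ : EnrichedFunctor V J V)

lemma actE_eq {i j : J} (u : 𝟙_ V ⟶ (i ⟹[V] j)) : actE φ u = uncurry' (u ≫ φ.map i j) := by
  rw [actE, act, BraidedCategory.braiding_naturality_left_assoc, uncurry', uncurry_natural_left,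
    leftUnitor_inv_braiding_assoc]

lemma act_actE (i : J) {j l : J} (u : 𝟙_ V ⟶ (j ⟹[V] l)) :
    act φ i j ≫ actE φ u = postC i u ▷ _ ≫ act φ i l := by
  rw [actE_eq, act, act, BraidedCategory.braiding_naturality_left_assoc, Category.assoc,
    ← uncurry_natural_right, ← uncurry_natural_left, postC_map]
  exact congrArg (fun x => (β_ _ _).hom ≫ uncurry (φ.map i j ≫ x)) (postC_self _).symm

lemma actE_act {i j : J} (u : 𝟙_ V ⟶ (i ⟹[V] j)) (l : J) :
    _ ◁ actE φ u ≫ act φ j l = preC u l ▷ _ ≫ act φ i l := by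
  rw [actE_eq, act, act, BraidedCategory.braiding_naturality_left_assoc,
    BraidedCategory.braiding_naturality_right_assoc,
    ← uncurry_natural_left, preC_map, ← MonoidalClosed.uncurry_pre_app]
  exact congrArg (fun x => (β_ _ _).hom ≫ uncurry (φ.map j l ≫ x)) (preC_self _).symm

lemma comp_postC_eq {x y z : C} (u : 𝟙_ V ⟶ (x ⟹[V] y)) (v : 𝟙_ V ⟶ (y ⟹[V] z)) :
    u ≫ postC x v = compE u v := by
  rw [postC, compE, rightUnitor_inv_naturality_assoc, unitors_inv_equal,
    MonoidalCategory.tensorHom_def_assoc]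

lemma actE_actE {i j l : J} (u : 𝟙_ V ⟶ (i ⟹[V] j)) (v : 𝟙_ V ⟶ (j ⟹[V] l)) :
    actE φ u ≫ actE φ v = actE φ (compE u v) := by
  rw [actE, Category.assoc, Category.assoc, act_actE, ← comp_whiskerRight_assoc,
    comp_postC_eq, actE]

lemma actE_id (i : J) : actE φ (eId V i) = 𝟙 _ := by
  rw [actE_eq, EnrichedFunctor.map_id]
  exact (congrArg (fun f => uncurry' f) (curry'_id (φ.obj i)).symm).trans (uncurry'_curry' _)

lemma preC_op {x y : C} (u : 𝟙_ V ⟶ (y ⟹[V] x)) (z : C) :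
    preC (V := V) (C := Cᵒᵖ) (x := Opposite.op x) (y := Opposite.op y) u (Opposite.op z) =
      postC (V := V) z u := by
  rw [postC, ← leftUnitor_inv_braiding_assoc, ← BraidedCategory.braiding_naturality_left_assoc]
  rfl

lemma postC_op {x y : C} (u : 𝟙_ V ⟶ (y ⟹[V] x)) (z : C) :
    postC (V := V) (C := Cᵒᵖ) (y := Opposite.op x) (z := Opposite.op y) (Opposite.op z) u =
      preC (V := V) u z := by
  rw [preC, ← rightUnitor_inv_braiding_assoc, ← BraidedCategory.braiding_naturality_right_assoc]
  rfl

lemma comp_preC_eq {x y z : C} (u : 𝟙_ V ⟶ (x ⟹[V] y)) (v : 𝟙_ V ⟶ (y ⟹[V] z)) :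
    v ≫ preC u z = compE u v := by
  rw [preC, compE, leftUnitor_inv_naturality_assoc, MonoidalCategory.tensorHom_def'_assoc]

lemma preC_map_unop (T : EnrichedFunctor V J Cᵒᵖ) {i j : J} (u : 𝟙_ V ⟶ (i ⟹[V] j)) (l : J) :
    preC u l ≫ T.map i l = T.map j l ≫ postC (V := V) (T.obj l).unop
      (u ≫ T.map i j : 𝟙_ V ⟶ ((T.obj j).unop ⟹[V] (T.obj i).unop)) := by
  rw [← preC_op]
  exact preC_map T u l

lemma postC_map_unop (T : EnrichedFunctor V J Cᵒᵖ) (i : J) {j l : J} (u : 𝟙_ V ⟶ (j ⟹[V] l)) :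
    postC i u ≫ T.map i l = T.map i j ≫ preC (V := V)
      (u ≫ T.map j l : 𝟙_ V ⟶ ((T.obj l).unop ⟹[V] (T.obj j).unop)) (T.obj i).unop := by
  rw [← postC_op]
  exact postC_map T i u

/-- Naturality with respect to an element of `J(i, j)`. -/
lemma IsNat.actE_comp {φ : EnrichedFunctor V J V} {t : J → C}
    {tm : ∀ i j, (i ⟹[V] j) ⟶ (t j ⟹[V] t i)} {a : C} {X : V}
    {s : ∀ j, φ.obj j ⊗ X ⟶ (t j ⟹[V] a)} (hs : IsNat φ tm s) {i j : J}
    (u : 𝟙_ V ⟶ (i ⟹[V] j)) : actE φ u ▷ X ≫ s j = s i ≫ preC (u ≫ tm i j) a := by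
  have h := (λ_ (φ.obj i ⊗ X)).inv ≫= u ▷ _ ≫= hs i j
  rw [actE, preC, leftUnitor_inv_naturality_assoc, comp_whiskerRight_assoc,
    whisker_exchange_assoc, ← MonoidalCategory.tensorHom_def_assoc]
  rw [MonoidalCategory.whiskerRight_comp_tensorHom_assoc] at h
  rw [← h]
  simp

/-- A weighted colimit of a diagram indexed by `J` may be computed over a skeleton of `J`. -/
lemma exists_colim_of_skeleton {I : Type w} (r : I → J) (ρ : J → I) (hρ : Function.Surjective ρ)
    (u : ∀ j, 𝟙_ V ⟶ (r (ρ j) ⟹[V] j)) (v : ∀ j, 𝟙_ V ⟶ (j ⟹[V] r (ρ j)))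
    (huv : ∀ j, compE (u j) (v j) = eId V _) (hvu : ∀ j, compE (v j) (u j) = eId V _)
    {t : J → C} {tm : ∀ i j, (i ⟹[V] j) ⟶ (t j ⟹[V] t i)}
    (hid : ∀ j, eId V j ≫ tm j j = eId V (t j))
    (hpre : ∀ {i j : J} (u : 𝟙_ V ⟶ (i ⟹[V] j)) (l : J),
      preC u l ≫ tm i l = tm j l ≫ postC (t l) (u ≫ tm i j))
    (hpost : ∀ (i : J) {j l : J} (u : 𝟙_ V ⟶ (j ⟹[V] l)),
      postC i u ≫ tm i l = tm i j ≫ preC (u ≫ tm j l) (t i))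
    (c : C) (m : ∀ i, φ.obj (r i) ⟶ (t (r i) ⟹[V] c))
    (hm : ∀ i j, act φ (r i) (r j) ≫ m j =
      (tm (r i) (r j) ⊗ₘ m i) ≫ eComp V (t (r j)) (t (r i)) c)
    (hc : ∀ (a : C) (X : V) (s : ∀ i, φ.obj (r i) ⊗ X ⟶ (t (r i) ⟹[V] a)),
      (∀ i j, (α_ _ _ _).inv ≫ act φ (r i) (r j) ▷ X ≫ s j =
        (tm (r i) (r j) ⊗ₘ s i) ≫ eComp V (t (r j)) (t (r i)) a) →
      ∃! f : X ⟶ (c ⟹[V] a), ∀ i, (m i ⊗ₘ f) ≫ eComp V (t (r i)) c a = s i) :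
    ∃ m : ∀ j, φ.obj j ⟶ (t j ⟹[V] c), IsCocone φ tm m ∧ IsColim φ tm m := by
  have pre_tm {i j l : J} (w : 𝟙_ V ⟶ (i ⟹[V] j)) (w' : 𝟙_ V ⟶ (j ⟹[V] l)) (a : C) :
      preC (w ≫ tm i j) a ≫ preC (w' ≫ tm j l) a = preC (compE w w' ≫ tm i l) a := by
    rw [preC_preC, ← comp_postC_eq, Category.assoc, ← hpre, ← Category.assoc, comp_preC_eq]
  have pre_id (j : J) (a : C) : preC (eId V j ≫ tm j j) a = 𝟙 _ := by
    rw [hid, preC_id]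
  -- The action of the diagram on `J(i, j)` is determined by its action on the representatives,
  -- through the chosen isomorphisms.
  have conj (i j : J) : tm i j ≫ postC (t j) (u i ≫ tm (r (ρ i)) i) =
      postC i (v j) ≫ preC (u i) (r (ρ j)) ≫ tm (r (ρ i)) (r (ρ j)) ≫
        preC (u j ≫ tm (r (ρ j)) j) (t (r (ρ i))) := by
    rw [← hpost, ← hpre, ← reassoc_of% pre_post, reassoc_of% postC_postC, hvu, postC_id,
      Category.id_comp]
  -- The cocone is extended from representatives to all `j` along `j ≅ r (ρ j)`: covariantly in the
  -- weight, contravariantly in the diagram.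
  let m' (j : J) : φ.obj j ⟶ (t j ⟹[V] c) :=
    actE φ (v j) ≫ m (ρ j) ≫ preC (u j ≫ tm (r (ρ j)) j) c
  have hm' : IsCocone φ tm m' := by
    intro i j
    have h1 : act φ i (r (ρ j)) =
        (preC (u i) _ ⊗ₘ actE φ (v i)) ≫ act φ (r (ρ i)) (r (ρ j)) := by
      rw [MonoidalCategory.tensorHom_def'_assoc, ← actE_act, ← MonoidalCategory.whiskerLeft_comp_assoc,
        actE_actE, hvu, actE_id, MonoidalCategory.whiskerLeft_id, Category.id_comp]
    dsimp only [m']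
    rw [reassoc_of% act_actE, h1, Category.assoc, reassoc_of% hm, ← Category.assoc (actE φ (v i)),
      tensor_preC, conj, ← tensor_preC',
      tensorHom_comp_tensorHom_assoc, MonoidalCategory.whiskerRight_comp_tensorHom_assoc]
  have hcomp {a : C} {X : V} (f : X ⟶ (c ⟹[V] a)) (j : J) :
      (m' j ⊗ₘ f) ≫ eComp V (t j) c a = actE φ (v j) ▷ X ≫
        ((m (ρ j) ⊗ₘ f) ≫ eComp V (t (r (ρ j))) c a) ≫ preC (u j ≫ tm _ j) a := by
    dsimp only [m']
    rw [← Category.assoc (actE φ (v j)), tensor_preC', ← MonoidalCategory.whiskerRight_comp_tensorHom_assoc,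
      Category.assoc]
  refine ⟨m', hm', fun a X s hs => ?_⟩
  obtain ⟨f, hf, hf'⟩ := hc a X (fun i => s (r i)) (fun i j => hs (r i) (r j))
  refine ⟨f, fun j => ?_, fun g hg => hf' g fun i => ?_⟩
  · refine (hcomp f j).trans ?_
    have h : actE φ (v j) ▷ X ≫ s (r (ρ j)) = s j ≫ preC (v j ≫ tm j _) a := hs.actE_comp (v j)
    rw [hf, reassoc_of% h, pre_tm, hvu, pre_id, Category.comp_id]
  -- Every index is some `ρ j`, so the condition at `i` is recovered from the one at `j` by
  -- cancelling the isomorphism.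
  · obtain ⟨j, rfl⟩ := hρ i
    have h : actE φ (u j) ▷ X ≫ s j = s (r (ρ j)) ≫ preC (u j ≫ tm _ j) a := hs.actE_comp (u j)
    have h' : actE φ (u j) ▷ X ≫ s j = ((m (ρ j) ⊗ₘ g) ≫ eComp V (t (r (ρ j))) c a) ≫
        preC (u j ≫ tm _ j) a := by
      rw [← hg j]
      refine (congrArg (actE φ (u j) ▷ X ≫ ·) (hcomp g j)).trans ?_
      rw [← comp_whiskerRight_assoc, actE_actE, huv, actE_id, id_whiskerRight, Category.id_comp]
    have h2 := (h'.symm.trans h) =≫ preC (v j ≫ tm j _) a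
    simpa only [Category.assoc, pre_tm, huv, pre_id, Category.comp_id] using h2

/-- `V` has all small weighted colimits. -/
lemma hasColims_self [HasColimits V] [IsSmallVCat V J] : HasColims φ V := by
  intro T
  obtain ⟨I, r, ρ, hρ, u, v, huv, hvu⟩ := exists_small_skeleton (V := V) J
  obtain ⟨c, m, hm, hc⟩ := exists_colim_of_small (fun i => φ.obj (r i))
    (fun i => (T.obj (r i)).unop) (fun i j => (r i ⟹[V] r j)) (fun i j => act φ (r i) (r j))
    (fun i j => T.map (r i) (r j))
  exact ⟨c, exists_colim_of_skeleton φ r ρ hρ u v huv hvu (fun j => T.map_id j)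
    (fun u l => preC_map_unop T u l) (fun i _ _ u => postC_map_unop T i u) c m hm hc⟩

end Small

/-! ### Colimits in functor categories: detection by evaluation. -/

section Pointwise
variable [HasLimits V] {K : Type k''} [EnrichedCategory V K] [IsSmallVCat V K]

/-- The V-natural transformation given by a morphism into `[K, C](F, G)`. -/
noncomputable def VNat.ofHom {F G : EnrichedFunctor V K C} {X : V} (f : X ⟶ natObj F G) :
    VNat X F G :=
  VNat.reindex f (natProj F G)

variable (V K C) in
/-- Evaluation at `k` as a V-functor `[K, C] → C`. -/
noncomputable def evalFunctor (k : K) : EnrichedFunctor V (EnrichedFunctor V K C) C where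
  obj F := F.obj k
  map F G := (natProj F G).app k
  map_id _ := natLift_proj _ k
  map_comp _ _ _ := natLift_proj _ k

/-- Shows that the factorizations `g k` found pointwise are V-natural. Their naturality square is
tested against the cocone at `k`, where it reduces to naturality of `m` and `s`. -/
lemma comp_natural_aux {P X : V} {T c F : EnrichedFunctor V K C} (m : VNat P T c)
    (s : VNat (P ⊗ X) T F) (g : ∀ k, X ⟶ (c.obj k ⟹[V] F.obj k))
    (hg : ∀ k, (m.app k ⊗ₘ g k) ≫ eComp V _ _ _ = s.app k) (k l : K) :
    (m.app k ⊗ₘ ((β_ X (k ⟹[V] l)).hom ≫ (c.map k l ⊗ₘ g l) ≫ eComp V _ _ _)) ≫ eComp V _ _ _ =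
      (m.app k ⊗ₘ ((g k ⊗ₘ F.map k l) ≫ eComp V _ _ _)) ≫ eComp V _ _ _ := by
  have h1 := tensor_comp_assoc (m.app k) (g k) (F.map k l)
  have h2 := tensor_comp_assoc (m.app k) (c.map k l) (g l)
  have h3 := tensor_comp_assoc (T.map k l) (m.app l) (g l)
  rw [← Iso.inv_comp_eq] at h1 h2
  rw [hg] at h1 h3
  rw [← MonoidalCategory.whiskerLeft_comp_tensorHom_assoc, ← h2, ← h1, ← m.naturality k l,
    ← MonoidalCategory.whiskerRight_comp_tensorHom_assoc, h3, ← s.naturality k l,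
    BraidedCategory.braiding_tensor_left_hom]
  simp

variable {φ : EnrichedFunctor V J V} {t : J → EnrichedFunctor V K C}
  {tm : ∀ i j, (i ⟹[V] j) ⟶ (t j ⟹[V] t i)} {c : EnrichedFunctor V K C}
  {m : ∀ j, φ.obj j ⟶ (t j ⟹[V] c)}

lemma hom_comp_proj {F G H : EnrichedFunctor V K C} {X Y : V} (f : X ⟶ (F ⟹[V] G))
    (g : Y ⟶ (G ⟹[V] H)) (k : K) : ((f ⊗ₘ g) ≫ eComp V F G H) ≫ (natProj F H).app k =
      ((f ≫ (natProj F G).app k) ⊗ₘ (g ≫ (natProj G H).app k)) ≫ eComp V _ _ _ := by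
  rw [← tensorHom_comp_tensorHom_assoc, Category.assoc]
  exact congrArg ((f ⊗ₘ g) ≫ ·) (natLift_proj _ k)

/-- Colimits in a functor V-category are detected pointwise. -/
lemma IsColim.of_eval (hm : IsCocone φ tm m)
    (hc : ∀ k, IsColim φ (t := fun j => (t j).obj k) (c := c.obj k)
      (fun i j => tm i j ≫ (natProj _ _).app k) (fun j => m j ≫ (natProj _ _).app k)) :
    IsColim φ tm m := by
  have hmk (k : K) := hm.map (evalFunctor V C K k)
  intro F X s hs
  have hsk (k : K) := hs.map (evalFunctor V C K k)
  choose g hg hg' using fun k => hc k (F.obj k) X _ (hsk k)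
  let σ : VNat X c F :=
    { app := g
      naturality k l := (hc k).hom_ext (hmk k) fun j =>
        comp_natural_aux (VNat.ofHom (m j)) (VNat.ofHom (s j)) g (fun k => hg k j) k l }
  refine ⟨natLift σ, fun j => natObj_hom_ext fun k => ?_, fun f hf => natObj_hom_ext fun k => ?_⟩
  · rw [hom_comp_proj, natLift_proj]
    exact hg k j
  · rw [natLift_proj]
    exact hg' k _ fun j => (hom_comp_proj (m j) f k).symm.trans (congrArg (· ≫ (natProj _ _).app k) (hf j))

/-- With `x` the colimit at `l`, this is the family inducing the action `K(k, l) → C(c k, c l)` of a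
pointwise colimit. -/
lemma isNat_of_vnat {k l : K} {x : C} (m : ∀ j, φ.obj j ⟶ ((t j).obj l ⟹[V] x))
    (hm : IsCocone φ (t := fun j => (t j).obj l) (fun i j => tm i j ≫ (natProj _ _).app l) m) :
    IsNat φ (t := fun j => (t j).obj k) (X := k ⟹[V] l) (a := x)
      (fun i j => tm i j ≫ (natProj _ _).app k)
      (fun j => (β_ _ _).hom ≫ ((t j).map k l ⊗ₘ m j) ≫ eComp V _ _ _) := by
  intro i j
  have h1 := (VNat.ofHom (tm i j)).naturality k l
  have h2 := tensor_comp_assoc ((t j).map k l) ((VNat.ofHom (tm i j)).app l) (m i)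
  have h3 := tensor_comp_assoc ((VNat.ofHom (tm i j)).app k) ((t i).map k l) (m i)
  rw [← Iso.inv_comp_eq] at h2 h3
  change _ = ((VNat.ofHom (tm i j)).app k ⊗ₘ _) ≫ _
  rw [← MonoidalCategory.whiskerLeft_comp_tensorHom_assoc, ← h3, ← h1,
    ← MonoidalCategory.whiskerRight_comp_tensorHom_assoc,
    BraidedCategory.braiding_naturality_left_assoc,
    MonoidalCategory.whiskerLeft_comp_tensorHom_assoc, hm i j]
  change _ ≫ _ ≫ (_ ⊗ₘ ((VNat.ofHom (tm i j)).app l ⊗ₘ _) ≫ _) ≫ _ = _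
  rw [← h2, BraidedCategory.braiding_tensor_left_hom]
  simp

end Pointwise

/-! ### Colimits in functor categories: existence, and preservation by evaluation. -/

section Existence
variable [HasLimits V] {K : Type k''} [EnrichedCategory V K] [IsSmallVCat V K]

/-- Functor V-categories have all colimits that the codomain has, and these are pointwise. -/
lemma exists_pointwise_colim {φ : EnrichedFunctor V J V} (hC : HasColims φ C)
    (T : EnrichedFunctor V J (EnrichedFunctor V K C)ᵒᵖ) :
    ∃ (c : EnrichedFunctor V K C) (m : ∀ j, φ.obj j ⟶ ((T.obj j).unop ⟹[V] c)),
      IsCocone φ (t := fun j => (T.obj j).unop) T.map m ∧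
      ∀ k, IsColim φ (t := fun j => (T.obj j).unop.obj k) (c := c.obj k)
        (fun i j => T.map i j ≫ (natProj _ _).app k) (fun j => m j ≫ (natProj _ _).app k) := by
  let t (j : J) : EnrichedFunctor V K C := (T.obj j).unop
  let tm (i j : J) : (i ⟹[V] j) ⟶ (t j ⟹[V] t i) := T.map i j
  have H (k : K) : ∃ (c : C) (m : ∀ j, φ.obj j ⟶ ((t j).obj k ⟹[V] c)),
      IsCocone φ (t := fun j => (t j).obj k) (fun i j => tm i j ≫ (natProj _ _).app k) m ∧
      IsColim φ (t := fun j => (t j).obj k) (fun i j => tm i j ≫ (natProj _ _).app k) m :=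
    hC (T.comp V (opFunctor (evalFunctor V C K k)))
  choose c m hm hc using H
  have hnat (k l : K) := isNat_of_vnat (k := k) (x := c l) (m l) (hm l)
  -- The hom-object `K(k, l)` serves as the parameter. Functoriality of the resulting `f` is checked
  -- below against the colimit cocones.
  choose f hf hf' using fun k l => hc k (c l) (k ⟹[V] l) _ (hnat k l)
  let c' : EnrichedFunctor V K C :=
    { obj := c
      map := f
      map_id k := (hc k).hom_ext (hm k) fun j => by
        rw [tensor_id_comp, ← MonoidalCategory.whiskerLeft_comp_tensorHom_assoc, hf,
          BraidedCategory.braiding_naturality_right_assoc,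
          MonoidalCategory.whiskerRight_comp_tensorHom_assoc, EnrichedFunctor.map_id,
          id_tensor_comp, braiding_tensorUnit_right]
        simp
      map_comp k l n := (hc k).hom_ext (hm k) fun j => by
        have h1 := tensor_comp_assoc ((t j).map k l) ((t j).map l n) (m n j)
        have h2 := tensor_comp_assoc (m k j) (f k l) (f l n)
        have h3 := tensor_comp_assoc ((t j).map k l) (m l j) (f l n)
        rw [← Iso.inv_comp_eq] at h2
        rw [hf] at h2 h3
        rw [← MonoidalCategory.whiskerLeft_comp_tensorHom_assoc, hf,
          BraidedCategory.braiding_naturality_right_assoc,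
          MonoidalCategory.whiskerRight_comp_tensorHom_assoc, EnrichedFunctor.map_comp, h1,
          ← h2, ← MonoidalCategory.whiskerRight_comp_tensorHom_assoc, h3,
          BraidedCategory.braiding_tensor_right_hom]
        simp only [Category.assoc, Iso.inv_hom_id_assoc,
          MonoidalCategory.whiskerLeft_comp_tensorHom_assoc] }
  let M (j : J) : VNat (φ.obj j) (t j) c' :=
    { app k := m k j
      naturality k l := (hf k l j).symm }
  refine ⟨c', fun j => natLift (M j), fun i j => natObj_hom_ext fun k => ?_, fun k => ?_⟩
  · rw [Category.assoc, natLift_proj]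
    refine (hm k i j).trans ?_
    refine Eq.trans ?_ (hom_comp_proj (tm i j) (natLift (M i)) k).symm
    rw [natLift_proj]
  · exact (isColim_congr (fun _ _ => rfl) fun j => natLift_proj (M j) k).2 (hc k)

lemma hasColims_functorVCat {φ : EnrichedFunctor V J V} (hC : HasColims φ C) :
    HasColims φ (EnrichedFunctor V K C) := fun T => by
  obtain ⟨c, m, hm, hc⟩ := exists_pointwise_colim hC T
  exact ⟨c, m, hm, IsColim.of_eval hm hc⟩

/-- Evaluation functors preserve colimits. -/
lemma preservesColims_evalFunctor {φ : EnrichedFunctor V J V} (hC : HasColims φ C) (k : K) :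
    PreservesColims φ (evalFunctor V C K k) := fun T c' m' hm' hc' => by
  -- The constructed colimit is pointwise; by uniqueness every other colimit of the diagram is too.
  obtain ⟨c, m, hm, hc⟩ := exists_pointwise_colim hC T
  exact (IsColim.of_eval hm hc).map_of_map hm (F := evalFunctor V C K k) (hc k) hc' hm'

end Existence

/-! ### Nerves, and closure of atomic objects under colimits. -/

section Nerve

/-- Associativity in `C`: precomposition along the diagram commutes with postcomposition. -/
lemma nerve_naturality_aux {x x' a b : C} {H : V} (g : H ⟶ (x' ⟹[V] x)) :
    (β_ (a ⟹[V] b) H).hom ≫ ((g ≫ curry ((β_ _ _).hom ≫ eComp V x' x a)) ⊗ₘ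
        curry (eComp V x' a b)) ≫ MonoidalClosed.comp (x ⟹[V] a) (x' ⟹[V] a) (x' ⟹[V] b) =
      (curry (eComp V x a b) ⊗ₘ (g ≫ curry ((β_ _ _).hom ≫ eComp V x' x b))) ≫
        MonoidalClosed.comp (x ⟹[V] a) (x ⟹[V] b) (x' ⟹[V] b) := by
  rw [natural_iff_uncurry, uncurry_natural_left, uncurry_curry, uncurry_curry, uncurry_curry,
    ← BraidedCategory.braiding_naturality_left_assoc, SymmetricCategory.symmetry_assoc,
    comp_whiskerRight_assoc, ← e_assoc']
  simp [MonoidalCategory.tensorHom_def]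

variable [HasLimits V] [IsSmallVCat V J]

/-- For `T : J → Cᵒᵖ`, the V-functor `C → [J, V]` that sends `a` to `C(T -, a)`. -/
noncomputable def nerve (T : EnrichedFunctor V J Cᵒᵖ) :
    EnrichedFunctor V C (EnrichedFunctor V J V) where
  obj a := T.comp V (representable (Opposite.op a))
  map a b := natLift
    { app j := curry (eComp V (T.obj j).unop a b)
      naturality i j := nerve_naturality_aux (x := (T.obj i).unop) (x' := (T.obj j).unop)
        (T.map i j) }
  map_id a := natObj_hom_ext fun j => by
    rw [Category.assoc, natLift_proj]
    exact ((representable (V := V) (T.obj j).unop).map_id a).trans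
      ((evalFunctor V V J j).map_id (T.comp V (representable (Opposite.op a)))).symm
  map_comp a b c := natObj_hom_ext fun j => by
    rw [Category.assoc, natLift_proj, hom_comp_proj, natLift_proj, natLift_proj]
    exact (representable (V := V) (T.obj j).unop).map_comp a b c

lemma nerve_map_proj (T : EnrichedFunctor V J Cᵒᵖ) (a b : C) (j : J) :
    (nerve T).map a b ≫ (natProj ((nerve T).obj a) ((nerve T).obj b)).app j =
      curry (eComp V (T.obj j).unop a b) :=
  natLift_proj _ j

lemma comp_nerve_map_proj (T : EnrichedFunctor V J Cᵒᵖ) {a b : C} {X : V} (f : X ⟶ (a ⟹[V] b))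
    (j : J) : (f ≫ (nerve T).map a b) ≫ (natProj ((nerve T).obj a) ((nerve T).obj b)).app j =
      f ≫ (representable (V := V) (T.obj j).unop).map a b :=
  (Category.assoc _ _ _).trans (congrArg (f ≫ ·) (nerve_map_proj T a b j))

lemma PreservesColims.comp {L : Type k} [EnrichedCategory V L] {φ : EnrichedFunctor V L V}
    {E : Type t} [EnrichedCategory V E]
    {F : EnrichedFunctor V C D} {G : EnrichedFunctor V D E} (hF : PreservesColims φ F)
    (hG : PreservesColims φ G) : PreservesColims φ (F.comp V G) := fun S c m hm hc =>
  (isColim_congr (fun _ _ => Category.assoc _ _ _) fun _ => Category.assoc _ _ _).1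
    (hG (S.comp V (opFunctor F)) (F.obj c) (fun l => m l ≫ F.map _ _) (hm.map F) (hF S c m hm hc))

/-- Colimits in `[J, V]` are detected pointwise, and the nerve followed by evaluation at `j` is the
representable of `T j`. -/
lemma preservesColims_nerve {L : Type k} [EnrichedCategory V L] {φ : EnrichedFunctor V L V}
    (T : EnrichedFunctor V J Cᵒᵖ)
    (hT : ∀ j, PreservesColims φ (representable (V := V) (T.obj j).unop)) :
    PreservesColims φ (nerve T) := fun S c m hm hc =>
  IsColim.of_eval (hm.map (nerve T)) fun j =>
    (isColim_congr
      (fun i l => comp_nerve_map_proj T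
        (S.map i l : _ ⟶ ((S.obj l).unop ⟹[V] (S.obj i).unop)) j)
      fun l => comp_nerve_map_proj T (m l) j).2
      (hT j S c m hm hc)

section
variable {ψ : EnrichedFunctor V J V} {T : EnrichedFunctor V J Cᵒᵖ} {b : C}
  {n : ∀ j, ψ.obj j ⟶ ((T.obj j).unop ⟹[V] b)}

/-- The comparison `C(b, a) → [J, V](ψ, C(T -, a))` for a cocone with vertex `b`. -/
noncomputable def nerveComparison (hn : IsCocone ψ (t := fun j => (T.obj j).unop) T.map n) (a : C) :
    (b ⟹[V] a) ⟶ natObj ψ ((nerve T).obj a) :=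
  natLift
    { app j := curry (n j ▷ (b ⟹[V] a) ≫ eComp V _ _ _)
      naturality := (vnat_iff_isNat T _).2 (by
        have h : (fun j => (n j ⊗ₘ 𝟙 (b ⟹[V] a)) ≫ eComp V _ _ _) = fun j =>
            uncurry (curry (n j ▷ (b ⟹[V] a) ≫ eComp V (T.obj j).unop b a)) :=
          funext fun j => by rw [uncurry_curry, MonoidalCategory.tensorHom_id]
        exact h ▸ hn.isNat_comp (𝟙 _)) }

lemma nerveComparison_proj (hn : IsCocone ψ (t := fun j => (T.obj j).unop) T.map n) (a : C)
    (j : J) : nerveComparison hn a ≫ (natProj ψ ((nerve T).obj a)).app j =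
      curry (n j ▷ (b ⟹[V] a) ≫ eComp V _ _ _) :=
  natLift_proj _ j

lemma comp_comparison {A X : V} {x b a : C} (n : A ⟶ (x ⟹[V] b)) (f : X ⟶ (b ⟹[V] a))
    (p : X ⟶ (ihom A).obj (x ⟹[V] a)) (h : (n ⊗ₘ f) ≫ eComp V x b a = uncurry p) :
    f ≫ curry (n ▷ _ ≫ eComp V x b a) = p := by
  rw [← curry_natural_left, ← MonoidalCategory.tensorHom_def'_assoc, h, curry_uncurry]

lemma comparison_comp {A X : V} {x b a : C} (n : A ⟶ (x ⟹[V] b)) (f : X ⟶ (b ⟹[V] a))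
    (p : X ⟶ (ihom A).obj (x ⟹[V] a)) (h : (n ⊗ₘ f) ≫ eComp V x b a = uncurry p)
    (g : (b ⟹[V] a) ⟶ X) (hg : g ≫ p = curry (n ▷ _ ≫ eComp V x b a)) :
    (n ⊗ₘ (g ≫ f)) ≫ eComp V x b a = (n ⊗ₘ 𝟙 _) ≫ eComp V x b a := by
  rw [← MonoidalCategory.whiskerLeft_comp_tensorHom_assoc, h, ← uncurry_natural_left, hg,
    uncurry_curry, MonoidalCategory.tensorHom_id]

/-- The inverse is obtained by applying the colimit property to the universal natural family, with
parameter object `[J, V](ψ, C(T -, a))`. -/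
lemma isIso_nerveComparison (hn : IsCocone ψ (t := fun j => (T.obj j).unop) T.map n)
    (hn' : IsColim ψ (t := fun j => (T.obj j).unop) T.map n) (a : C) :
    IsIso (nerveComparison hn a) := by
  obtain ⟨f, hf, -⟩ := hn' a (natObj ψ ((nerve T).obj a)) _
    ((vnat_iff_isNat T (natProj ψ ((nerve T).obj a)).app).1 (natProj ψ ((nerve T).obj a)).naturality)
  refine ⟨f, hn'.hom_ext hn fun j => ?_, natObj_hom_ext fun j => ?_⟩
  · exact comparison_comp (n j) f _ (hf j) (nerveComparison hn a) (nerveComparison_proj hn a j)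
  · rw [Category.assoc, nerveComparison_proj, Category.id_comp]
    exact comp_comparison (n j) f _ (hf j)

lemma nerveComparison_naturality_aux {A : V} {x b a a' : C} (f : A ⟶ (x ⟹[V] b)) :
    (curry (f ▷ (b ⟹[V] a) ≫ eComp V x b a) ⊗ₘ curry (eComp V x a a')) ≫
        MonoidalClosed.comp A (x ⟹[V] a) (x ⟹[V] a') =
      eComp V b a a' ≫ curry (f ▷ (b ⟹[V] a') ≫ eComp V x b a') := by
  apply uncurry_injective
  rw [uncurry_tensor_comp, uncurry_natural_left, uncurry_curry, uncurry_curry, uncurry_curry,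
    comp_whiskerRight_assoc, ← e_assoc']
  rw [whisker_exchange_assoc]
  simp

/-- If `b` is the colimit of `T` weighted by `ψ`, and `ψ` and all the `T j` are atomic with respect
to `φ`, then so is `b`. -/
lemma preservesColims_representable_colim {L : Type k} [EnrichedCategory V L]
    {φ : EnrichedFunctor V L V}
    (hn : IsCocone ψ (t := fun j => (T.obj j).unop) T.map n)
    (hn' : IsColim ψ (t := fun j => (T.obj j).unop) T.map n)
    (hT : ∀ j, PreservesColims φ (representable (V := V) (T.obj j).unop))
    (hψ : PreservesColims φ (representable (V := V) ψ)) :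
    PreservesColims φ (representable (V := V) b) := by
  have := isIso_nerveComparison hn hn'
  -- The representable of `b` is isomorphic to the nerve of `T` followed by the representable of
  -- `ψ`. What remains is naturality of the comparison in `a`.
  refine ((preservesColims_nerve T hT).comp hψ).of_iso
    (fun a => (asIso (nerveComparison hn a)).symm) fun a a' => ?_
  have h : nerveComparison hn a ▷ (a ⟹[V] a') ≫ natObj ψ ((nerve T).obj a) ◁ (nerve T).map a a' ≫
      eComp V ψ ((nerve T).obj a) ((nerve T).obj a') = eComp V b a a' ≫ nerveComparison hn a' := by
    rw [← MonoidalCategory.tensorHom_def_assoc]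
    refine natObj_hom_ext fun j => (hom_comp_proj (nerveComparison hn a) _ j).trans ?_
    rw [Category.assoc, nerveComparison_proj, nerveComparison_proj, nerve_map_proj]
    exact nerveComparison_naturality_aux (n j)
  have h1 : uncurry (((nerve T).comp V (representable ψ)).map a a') =
      natObj ψ ((nerve T).obj a) ◁ (nerve T).map a a' ≫
        eComp V ψ ((nerve T).obj a) ((nerve T).obj a') :=
    (uncurry_natural_left _ _).trans (congrArg (_ ≫ ·) (uncurry_curry _))
  have h2 : uncurry ((representable b).map a a') = eComp V b a a' := uncurry_curry _
  have h3 : (natObj ψ ((nerve T).obj a) ◁ (nerve T).map a a' ≫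
      eComp V ψ ((nerve T).obj a) ((nerve T).obj a')) ≫ inv (nerveComparison hn a') =
      inv (nerveComparison hn a) ▷ (a ⟹[V] a') ≫ eComp V b a a' := by
    rw [IsIso.comp_inv_eq, Category.assoc, ← h, ← comp_whiskerRight_assoc, IsIso.inv_hom_id,
      id_whiskerRight, Category.id_comp]
  exact (congrArg (· ≫ _) h1).trans (h3.trans (congrArg (_ ≫ ·) h2.symm))

end

end Nerve

/-! ### The Yoneda and co-Yoneda lemmas. -/

section Yoneda

lemma act_comp (φ : EnrichedFunctor V J V) (i j l : J) :
    φ.obj i ◁ eComp V i j l ≫ uncurry (φ.map i l) =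
      (α_ _ _ _).inv ≫ uncurry (φ.map i j) ▷ _ ≫ uncurry (φ.map j l) := by
  rw [← uncurry_natural_left, φ.map_comp]
  exact uncurry_tensor_comp _ _

lemma act_assoc (φ : EnrichedFunctor V J V) (i j l : J) :
    (i ⟹[V] j) ◁ (β_ _ _).hom ≫ (α_ _ _ _).inv ≫ eComp V i j l ▷ φ.obj i ≫ act φ i l =
      (α_ _ _ _).inv ≫ act φ i j ▷ _ ≫ uncurry (φ.map j l) := by
  rw [act, BraidedCategory.braiding_naturality_left_assoc, act_comp,
    BraidedCategory.braiding_tensor_left_hom]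
  simp only [Category.assoc, Iso.inv_hom_id_assoc, Iso.hom_inv_id_assoc, act, comp_whiskerRight]
  rw [← MonoidalCategory.whiskerLeft_comp_assoc, SymmetricCategory.symmetry,
    MonoidalCategory.whiskerLeft_id, Category.id_comp]

lemma braiding_coherence (X Y Z : V) :
    (β_ Z (X ⊗ Y)).hom ≫ (α_ X Y Z).hom ≫ X ◁ (β_ Y Z).hom ≫ (α_ X Z Y).inv =
      (α_ Z X Y).inv ≫ (β_ Z X).hom ▷ Y := by
  rw [BraidedCategory.braiding_tensor_right_hom]
  simp only [Category.assoc, Iso.inv_hom_id_assoc]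
  rw [← MonoidalCategory.whiskerLeft_comp_assoc, SymmetricCategory.symmetry,
    MonoidalCategory.whiskerLeft_id, Category.id_comp, Iso.hom_inv_id, Category.comp_id]

lemma act_act (φ : EnrichedFunctor V J V) (i j l : J) :
    (j ⟹[V] l) ◁ act φ i j ≫ act φ j l =
      (α_ _ _ _).inv ≫ ((β_ _ _).hom ≫ eComp V i j l) ▷ φ.obj i ≫ act φ i l := by
  have h : (j ⟹[V] l) ◁ act φ i j ≫ act φ j l =
      (β_ _ _).hom ≫ act φ i j ▷ _ ≫ uncurry (φ.map j l) := by
    rw [act.eq_def φ j l, BraidedCategory.braiding_naturality_right_assoc]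
  have h' := act_assoc φ i j l
  rw [Iso.eq_inv_comp] at h'
  have h2 := braiding_coherence (i ⟹[V] j) (φ.obj i) (j ⟹[V] l)
  rw [h, ← h', reassoc_of% h2, comp_whiskerRight_assoc]

lemma VNat.act_naturality {X : V} {F G : EnrichedFunctor V J V} (σ : VNat X F G) (i j : J) :
    (α_ _ _ _).inv ≫ act F i j ▷ X ≫ uncurry (σ.app j) =
      (i ⟹[V] j) ◁ uncurry (σ.app i) ≫ act G i j := by
  have h : uncurry ((β_ X (i ⟹[V] j)).hom ≫ (F.map i j ⊗ₘ σ.app j) ≫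
      MonoidalClosed.comp _ _ _) = uncurry ((σ.app i ⊗ₘ G.map i j) ≫ MonoidalClosed.comp _ _ _) :=
    congrArg _ (σ.naturality i j)
  rw [uncurry_natural_left, uncurry_tensor_comp, uncurry_tensor_comp] at h
  have h2 := braiding_coherence (F.obj i) X (i ⟹[V] j)
  rw [Iso.eq_inv_comp] at h
  rw [act, act, BraidedCategory.braiding_naturality_right_assoc, ← h, reassoc_of% h2,
    comp_whiskerRight_assoc]

lemma eId_act (F : EnrichedFunctor V J V) (i : J) :
    (λ_ _).inv ≫ eId V i ▷ _ ≫ act F i i = 𝟙 (F.obj i) :=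
  actE_id F i

lemma curry_act_naturality (F : EnrichedFunctor V J V) (j i i' : J) :
    (β_ (F.obj j) (i ⟹[V] i')).hom ≫ (curry (eComp V j i i') ⊗ₘ curry (act F j i')) ≫
      MonoidalClosed.comp _ _ _ = (curry (act F j i) ⊗ₘ F.map i i') ≫
        MonoidalClosed.comp _ _ _ := by
  apply uncurry_injective
  rw [uncurry_natural_left, uncurry_tensor_comp, uncurry_tensor_comp, uncurry_curry, uncurry_curry,
    uncurry_curry, act_assoc]

/-- With `g` the Yoneda map and `e` an identity, this gives one of the two inverse laws in
`isIso_yonedaMap`. -/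
lemma comp_eval {A X B Y : V} (g : A ⟶ X) (p : X ⟶ (ihom B).obj Y) (q : B ⊗ A ⟶ Y)
    (h : g ≫ p = curry q) (e : 𝟙_ V ⟶ B) :
    g ≫ (λ_ _).inv ≫ e ▷ X ≫ uncurry p = (λ_ _).inv ≫ e ▷ A ≫ q := by
  rw [leftUnitor_inv_naturality_assoc, whisker_exchange_assoc, ← uncurry_natural_left, h,
    uncurry_curry]

/-- The other inverse law: by naturality, a transformation out of a representable is determined by
its value at the identity. -/
lemma eval_comp_curry_act (F : EnrichedFunctor V J V) {X : V} {i j : J}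
    (σ : X ⟶ (ihom (j ⟹[V] j)).obj (F.obj j)) (τ : X ⟶ (ihom (j ⟹[V] i)).obj (F.obj i))
    (h : (α_ _ _ _).inv ≫ ((β_ _ _).hom ≫ eComp V j j i) ▷ X ≫ uncurry τ =
      (j ⟹[V] i) ◁ uncurry σ ≫ act F j i) :
    ((λ_ _).inv ≫ eId V j ▷ X ≫ uncurry σ) ≫ curry (act F j i) = τ := by
  apply uncurry_injective
  have e : eId V j ▷ (j ⟹[V] i) ≫ eComp V j j i = (λ_ _).hom := by
    rw [← cancel_epi (λ_ _).inv, e_id_comp, Iso.inv_hom_id]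
  rw [uncurry_natural_left, uncurry_curry]
  simp only [MonoidalCategory.whiskerLeft_comp, Category.assoc]
  rw [← h, MonoidalCategory.associator_inv_naturality_middle_assoc, ← comp_whiskerRight_assoc,
    BraidedCategory.braiding_naturality_right_assoc, e, braiding_tensorUnit_right]
  simp

lemma existsUnique_desc_representable (φ : EnrichedFunctor V J V) (i : J) {a X : V}
    (s : ∀ j, φ.obj j ⊗ X ⟶ (ihom (j ⟹[V] i)).obj a)
    (hs : ∀ j j', (α_ _ _ _).inv ≫ act φ j j' ▷ X ≫ s j' =
      (curry ((β_ (j' ⟹[V] i) (j ⟹[V] j')).hom ≫ eComp V j j' i) ⊗ₘ s j) ≫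
        MonoidalClosed.comp (j' ⟹[V] i) (j ⟹[V] i) a) :
    ∃! f : X ⟶ (ihom (φ.obj i)).obj a, ∀ j, (curry (act φ j i) ⊗ₘ f) ≫
      MonoidalClosed.comp (j ⟹[V] i) (φ.obj i) a = s j := by
  have hcomp (f : X ⟶ (ihom (φ.obj i)).obj a) (j : J) :
      uncurry ((curry (act φ j i) ⊗ₘ f) ≫ MonoidalClosed.comp (j ⟹[V] i) (φ.obj i) a) =
        (α_ _ _ _).inv ≫ act φ j i ▷ X ≫ uncurry f := by
    rw [uncurry_tensor_comp, uncurry_curry]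
  -- The only candidate is `s i` evaluated at the identity of `i`. It works by naturality from `j`
  -- to `i`, again evaluated at that identity.
  refine ⟨curry ((λ_ _).inv ≫ eId V i ▷ _ ≫ uncurry (s i)), fun j => ?_, fun g hg => ?_⟩
  · apply uncurry_injective
    rw [hcomp, uncurry_curry]
    have h := (λ_ _).inv ≫= eId V i ▷ _ ≫= congrArg uncurry (hs j i)
    have e : (β_ _ _).hom ≫ (j ⟹[V] i) ◁ eId V i ≫ eComp V j i i = (λ_ _).hom := by
      rw [← cancel_epi (λ_ _).inv, leftUnitor_inv_braiding_assoc, e_comp_id, Iso.inv_hom_id]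
    rw [uncurry_natural_left, uncurry_natural_left, uncurry_tensor_comp, uncurry_curry,
      ← whisker_exchange_assoc, ← whisker_exchange_assoc,
      ← leftUnitor_inv_naturality_assoc, ← leftUnitor_inv_naturality_assoc,
      MonoidalCategory.associator_inv_naturality_left_assoc, ← comp_whiskerRight_assoc,
      BraidedCategory.braiding_naturality_left_assoc, e] at h
    simpa using h
  · apply uncurry_injective
    rw [uncurry_curry, ← hg i, hcomp, MonoidalCategory.associator_inv_naturality_left_assoc]
    have h := congrArg (· ▷ X) (eId_act φ i)
    simp only [comp_whiskerRight, id_whiskerRight] at h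
    have h' : (λ_ (φ.obj i ⊗ X)).inv ≫ (α_ _ _ _).inv = (λ_ (φ.obj i)).inv ▷ X := by simp
    rw [reassoc_of% h', reassoc_of% h]

/-- The co-Yoneda lemma in `V`: the colimit of `J(-, i)` weighted by `φ` is `φ i`. -/
lemma isColim_representable (φ : EnrichedFunctor V J V) (i : J) :
    IsColim φ (C := V) (t := fun j => (j ⟹[V] i)) (c := φ.obj i)
      (fun j j' => curry ((β_ (j' ⟹[V] i) (j ⟹[V] j')).hom ≫ eComp V j j' i))
      (fun j => curry (act φ j i)) :=
  fun _ _ s hs => existsUnique_desc_representable φ i s hs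

lemma yoneda_naturality_aux {F G : EnrichedFunctor V J V} {X : V} {j i : J}
    (σ : X ⟶ (ihom (F.obj j)).obj (G.obj j)) (τ : X ⟶ (ihom (F.obj i)).obj (G.obj i))
    (h : (α_ _ _ _).inv ≫ act F j i ▷ X ≫ uncurry τ = (j ⟹[V] i) ◁ uncurry σ ≫ act G j i) :
    uncurry σ ≫ curry (act G j i) = (curry (act F j i) ⊗ₘ τ) ≫ MonoidalClosed.comp _ _ _ := by
  apply uncurry_injective
  rw [uncurry_natural_left, uncurry_curry, uncurry_tensor_comp, uncurry_curry, h]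

lemma curry_act_cocone (φ : EnrichedFunctor V J V) (i j l : J) :
    act φ i j ≫ curry (act φ j l) =
      (curry ((β_ (j ⟹[V] l) (i ⟹[V] j)).hom ≫ eComp V i j l) ⊗ₘ curry (act φ i l)) ≫
        MonoidalClosed.comp _ _ _ := by
  apply uncurry_injective
  rw [uncurry_natural_left, uncurry_curry, uncurry_tensor_comp, uncurry_curry, uncurry_curry,
    act_act]

variable {K : Type k} [EnrichedCategory V K] [IsSmallVCat V K] [HasLimits V]

variable (V K) in
/-- The Yoneda embedding `K → [Kᵒᵖ, V]`. -/
noncomputable def yonedaFunctor : EnrichedFunctor V K (EnrichedFunctor V Kᵒᵖ V) :=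
  nerve (EnrichedFunctor.id V Kᵒᵖ)

/-- The Yoneda map `F j → [Kᵒᵖ, V](K(-, j), F)`. -/
noncomputable def yonedaMap (F : EnrichedFunctor V Kᵒᵖ V) (j : Kᵒᵖ) :
    F.obj j ⟶ natObj ((yonedaFunctor V K).obj j.unop) F :=
  natLift
    { app i := curry (act F j i)
      naturality i i' := (congrArg (fun f => (β_ _ _).hom ≫ (f ⊗ₘ curry (act F j i')) ≫
        MonoidalClosed.comp _ _ _) (Category.id_comp (curry (eComp V j i i')))).trans
          (curry_act_naturality F j i i') }

lemma yonedaMap_proj (F : EnrichedFunctor V Kᵒᵖ V) (j i : Kᵒᵖ) :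
    yonedaMap F j ≫ (natProj _ F).app i = curry (act F j i) :=
  natLift_proj _ i

lemma act_yonedaFunctor (j i i' : Kᵒᵖ) :
    act ((yonedaFunctor V K).obj j.unop) i i' = (β_ _ _).hom ≫ eComp V j i i' :=
  congrArg ((β_ _ _).hom ≫ ·) ((congrArg (fun x => uncurry x)
    (Category.id_comp (curry (eComp V j i i')))).trans (uncurry_curry _))

lemma isIso_yonedaMap (F : EnrichedFunctor V Kᵒᵖ V) (j : Kᵒᵖ) : IsIso (yonedaMap F j) := by
  refine ⟨(λ_ _).inv ≫ eId V j ▷ _ ≫ uncurry ((natProj _ F).app j),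
    (comp_eval _ _ _ (yonedaMap_proj F j j) (eId V j)).trans (eId_act F j),
    natObj_hom_ext fun i => ?_⟩
  rw [Category.assoc, yonedaMap_proj, Category.id_comp]
  have h := (natProj ((yonedaFunctor V K).obj j.unop) F).act_naturality j i
  rw [act_yonedaFunctor] at h
  exact eval_comp_curry_act F _ _ h

/-- By Yoneda this functor is isomorphic to evaluation at `x`, which preserves colimits because they
are pointwise. -/
lemma preservesColims_representable_yoneda {L : Type k} [EnrichedCategory V L]
    {φ : EnrichedFunctor V L V} (hV : HasColims φ V) (x : K) :
    PreservesColims φ (representable (V := V) ((yonedaFunctor V K).obj x)) := by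
  have (F : EnrichedFunctor V Kᵒᵖ V) := isIso_yonedaMap F (Opposite.op x)
  refine (preservesColims_evalFunctor hV (Opposite.op x)).of_iso
    (fun F => @asIso _ _ _ _ _ (this F)) fun F G => ?_
  refine Eq.trans ?_ (congrArg (yonedaMap F (Opposite.op x) ▷ natObj F G ≫ ·)
    (uncurry_curry (eComp V ((yonedaFunctor V K).obj x) F G)).symm)
  rw [← MonoidalCategory.tensorHom_id]
  refine natObj_hom_ext fun i => ?_
  refine Eq.trans ?_ (hom_comp_proj (yonedaMap F (Opposite.op x)) (𝟙 (natObj F G)) i).symm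
  rw [yonedaMap_proj, Category.id_comp]
  refine (Category.assoc _ _ _).trans ((congrArg (_ ≫ ·) (yonedaMap_proj G _ i)).trans ?_)
  exact yoneda_naturality_aux _ _ ((natProj F G).act_naturality (Opposite.op x) i)

/-- A weight is its own colimit of representables. -/
lemma isColim_yoneda (ψ : EnrichedFunctor V Kᵒᵖ V) :
    IsCocone ψ (t := fun j => (yonedaFunctor V K).obj j.unop) (c := ψ)
      (fun i j => (yonedaFunctor V K).map j.unop i.unop) (fun j => yonedaMap ψ j) ∧
    IsColim ψ (t := fun j => (yonedaFunctor V K).obj j.unop) (c := ψ)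
      (fun i j => (yonedaFunctor V K).map j.unop i.unop) (fun j => yonedaMap ψ j) := by
  have hmap (i j l : Kᵒᵖ) : (yonedaFunctor V K).map j.unop i.unop ≫ (natProj _ _).app l =
      curry ((β_ (j ⟹[V] l) (i ⟹[V] j)).hom ≫ eComp V i j l) :=
    (nerve_map_proj (EnrichedFunctor.id V Kᵒᵖ) j.unop i.unop l).trans
      (congrArg (fun x => curry x)
        (SymmetricCategory.symmetry_assoc _ _ (eComp V l.unop j.unop i.unop)).symm)
  have hm : IsCocone ψ (t := fun j => (yonedaFunctor V K).obj j.unop) (c := ψ)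
      (fun i j => (yonedaFunctor V K).map j.unop i.unop) (fun j => yonedaMap ψ j) := fun i j =>
    natObj_hom_ext fun l => by
      refine Eq.trans ?_ (hom_comp_proj _ (yonedaMap ψ i) l).symm
      rw [Category.assoc, yonedaMap_proj, yonedaMap_proj, hmap]
      exact curry_act_cocone ψ i j l
  -- Evaluated at `l`, the claim is the co-Yoneda lemma in `V`.
  exact ⟨hm, IsColim.of_eval hm fun l =>
    (isColim_congr (fun i j => hmap i j l) fun j => yonedaMap_proj ψ j l).2
      (isColim_representable ψ l)⟩

end Yoneda

/-! ### Full subcategories and copies in larger universes. -/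

section Induced
variable {A' : Type t} (f : A' → C)

/-- The V-category with objects `A'` and the hom-objects of `C` between the images under `f`. -/
def Induced {A' : Type t} {C : Type k'} (_f : A' → C) : Type t := A'

instance : EnrichedCategory V (Induced f) where
  Hom x y := f x ⟹[V] f y
  id x := eId V (f x)
  comp x y z := eComp V (f x) (f y) (f z)
  id_comp _ _ := e_id_comp V _ _
  comp_id _ _ := e_comp_id V _ _
  assoc _ _ _ _ := e_assoc V _ _ _ _

variable {f}

/-- The diagram in `C` given by a diagram in `Induced f`. -/
def forgetInduced (T : EnrichedFunctor V J (Induced f)ᵒᵖ) : EnrichedFunctor V J Cᵒᵖ where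
  obj j := Opposite.op (f (T.obj j).unop)
  map i j := T.map i j
  map_id j := T.map_id j
  map_comp i j l := T.map_comp i j l

/-- A copy of `C` in a larger universe. -/
abbrev Lifted.{a, b} (C : Type b) := Induced (ULift.down.{a, b} : ULift.{a} C → C)

variable (f) in
/-- The V-functor from `Induced f` to a copy of `D` in a larger universe given by `F : C → D`. -/
def liftFunctor (F : EnrichedFunctor V C D) :
    EnrichedFunctor V (Induced f) (Lifted.{r} D) where
  obj x := ULift.up (F.obj (f x))
  map x y := F.map (f x) (f y)
  map_id x := F.map_id (f x)
  map_comp x y z := F.map_comp (f x) (f y) (f z)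

/-- Surjectivity of `f` ensures that the universal property has been tested against every object of
`C`. -/
lemma IsColim.of_induced {φ : EnrichedFunctor V J V} (hf : Function.Surjective f) {t : J → A'}
    {tm : ∀ i j, (i ⟹[V] j) ⟶ (f (t j) ⟹[V] f (t i))} {c : A'}
    {m : ∀ j, φ.obj j ⟶ (f (t j) ⟹[V] f c)}
    (h : IsColim φ (C := Induced f) (t := t) (c := c) tm m) : IsColim φ tm m := by
  intro a X s hs
  obtain ⟨a, rfl⟩ := hf a
  exact h a X s hs

variable (f) in
/-- The image of `f` is closed under `φ`-weighted colimits. -/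
def ClosedUnderColims (φ : EnrichedFunctor V J V) : Prop :=
  ∀ T : EnrichedFunctor V J (Induced f)ᵒᵖ, ∃ (c : A')
    (m : ∀ j, φ.obj j ⟶ (f (T.obj j).unop ⟹[V] f c)),
      IsCocone φ (t := fun j => f (T.obj j).unop) (forgetInduced T).map m ∧
      IsColim φ (t := fun j => f (T.obj j).unop) (forgetInduced T).map m

lemma ClosedUnderColims.of_surjective {φ : EnrichedFunctor V J V} (hf : Function.Surjective f)
    (hC : HasColims φ C) : ClosedUnderColims f φ := fun T => by
  obtain ⟨c, m, hm, hc⟩ := hC (forgetInduced T)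
  obtain ⟨c, rfl⟩ := hf c
  exact ⟨c, m, hm, hc⟩

lemma ClosedUnderColims.hasColims {φ : EnrichedFunctor V J V} (h : ClosedUnderColims f φ) :
    HasColims φ (Induced f) := fun T => by
  obtain ⟨c, m, hm, hc⟩ := h T
  exact ⟨c, m, hm, fun a X s hs => hc (f a) X s hs⟩

/-- Closure means that colimits in `Induced f` may be computed in `C`, where `F` preserves them. It
is used for the inclusion of a full subcategory (`F` the identity) and for moving `F` to larger
universes (`f` the map `ULift.down`). -/
lemma ClosedUnderColims.preservesColims_liftFunctor {φ : EnrichedFunctor V J V}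
    (h : ClosedUnderColims f φ) {F : EnrichedFunctor V C D} (hF : PreservesColims φ F) :
    PreservesColims φ (liftFunctor f F : EnrichedFunctor V _ (Lifted.{r} D)) := fun T c m hm hc => by
  obtain ⟨c', m', hm', hc'⟩ := h T
  have h1 : IsColim φ (C := Induced f) (t := fun j => (T.obj j).unop) (c := c') T.map m' :=
    fun a X s hs => hc' (f a) X s hs
  have h2 := hF (forgetInduced T) (f c') m' hm' hc'
  exact IsColim.map_of_map (C := Induced f) (c := c') h1 hm' (F := liftFunctor f F) (fun a X s hs => h2 a.down X s hs) hc hm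

/-- The diagram in a copy of `C` in a larger universe given by a diagram in `C`. -/
def liftDiagram (T : EnrichedFunctor V J Cᵒᵖ) :
    EnrichedFunctor V J (Lifted.{r} C)ᵒᵖ where
  obj j := Opposite.op (ULift.up (T.obj j).unop)
  map i j := T.map i j
  map_id j := T.map_id j
  map_comp i j l := T.map_comp i j l

lemma preservesColims_of_liftFunctor {φ : EnrichedFunctor V J V} {F : EnrichedFunctor V C D}
    (h : PreservesColims φ (liftFunctor ULift.down F : EnrichedFunctor V (Lifted.{r} C) (Lifted.{r'} D))) :
    PreservesColims φ F := fun T c m hm hc =>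
  IsColim.of_induced (f := ULift.down) ULift.down_surjective
    (h (liftDiagram T) (ULift.up c) m hm fun a X s hs => hc a.down X s hs)

end Induced

/-! ### Stability of commutation under saturation in each variable. -/

section Main

lemma PreservesColims.representable_of_iso {φ : EnrichedFunctor V J V} {c c' : C}
    (h : PreservesColims φ (representable (V := V) c)) (p : 𝟙_ V ⟶ (c ⟹[V] c'))
    (q : 𝟙_ V ⟶ (c' ⟹[V] c)) (hpq : compE p q = eId V _) (hqp : compE q p = eId V _) :
    PreservesColims φ (representable (V := V) c') := by
  refine h.of_iso (fun a => ⟨preC q a, preC p a, ?_, ?_⟩) fun a b => ?_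
  · exact (preC_preC p q a).trans (by rw [hpq, preC_id])
  · exact (preC_preC q p a).trans (by rw [hqp, preC_id])
  · have h1 : uncurry ((representable c).map a b) = eComp V c a b := uncurry_curry _
    have h2 : uncurry ((representable c').map a b) = eComp V c' a b := uncurry_curry _
    exact (congrArg (· ≫ _) h1).trans ((comp_preC q a b).trans (congrArg (_ ≫ ·) h2.symm))

lemma preservesColims_id (φ : EnrichedFunctor V J V) :
    PreservesColims φ (EnrichedFunctor.id V C) := fun _ _ _ _ hc =>
  (isColim_congr (fun _ _ => (Category.comp_id _).symm) fun _ => (Category.comp_id _).symm).1 hc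

variable [HasLimits V]

lemma commutesWith_iff (φ ψ : Weight.{w, u, k} V) :
    CommutesWith φ ψ ↔ PreservesColims φ.functor (representable (V := V) ψ.functor) :=
  preservesWeightedColimits_iff _ _

variable [HasColimits V]

/-- Consequences of membership in the saturation, in terms of colimits. -/
lemma saturation_hasColims {Ψ : Set (Weight.{w, u, k} V)} {ψ : Weight.{w, u, k} V}
    (hψ : ψ ∈ saturation.{w, u, k, t} Ψ) (A : Type (max w u k t)) [EnrichedCategory V A]
    (hA : ∀ φ ∈ Ψ, HasColims φ.functor A) : HasColims ψ.functor A :=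
  (hasWeightedLimits_op_iff _).1
    (hψ.1 Aᵒᵖ (fun φ hφ => (hasWeightedLimits_op_iff _).2 (hA φ hφ)) ψ rfl)

/-- Saturation is defined through limits, so its second clause is applied to the opposite categories
and the opposite functor. -/
lemma saturation_preservesColims {Ψ : Set (Weight.{w, u, k} V)} {ψ : Weight.{w, u, k} V}
    (hψ : ψ ∈ saturation.{w, u, k, t} Ψ) {A B : Type (max w u k t)} [EnrichedCategory V A]
    [EnrichedCategory V B] (hA : ∀ φ ∈ Ψ, HasColims φ.functor A)
    (hB : ∀ φ ∈ Ψ, HasColims φ.functor B) {F : EnrichedFunctor V A B}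
    (hF : ∀ φ ∈ Ψ, PreservesColims φ.functor F) : PreservesColims ψ.functor F :=
  (preservesWeightedLimits_opFunctor_iff _ _).1
    (hψ.2 Aᵒᵖ Bᵒᵖ (fun φ hφ => (hasWeightedLimits_op_iff _).2 (hA φ hφ))
      (fun φ hφ => (hasWeightedLimits_op_iff _).2 (hB φ hφ)) (opFunctor F)
      (fun φ hφ => (preservesWeightedLimits_opFunctor_iff _ _).2 (hF φ hφ)) ψ rfl)

lemma subset_saturation (Ψ : Set (Weight.{w, u, k} V)) : Ψ ⊆ saturation.{w, u, k, t} Ψ :=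
  fun ψ hψ => ⟨fun _ _ h _ hφ => (Set.mem_singleton_iff.1 hφ) ▸ h ψ hψ,
    fun _ _ _ _ _ _ _ h _ hφ => (Set.mem_singleton_iff.1 hφ) ▸ h ψ hψ⟩

/-- The weights whose colimits commute with `ψ`-limits are closed under saturation. -/
lemma commutesWith_of_mem_saturation_left {Φ : Set (Weight.{w, u, k} V)} {φ ψ : Weight.{w, u, k} V}
    (hφ : φ ∈ saturation.{w, u, k, t} Φ) (h : ∀ φ' ∈ Φ, CommutesWith φ' ψ) : CommutesWith φ ψ := by
  rw [commutesWith_iff]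
  have hV (φ' : Weight.{w, u, k} V) : HasColims φ'.functor V := hasColims_self _
  -- Saturation tests categories in `Type (max w u k t)`, so both `[Kᵒᵖ, V]` and `V` are replaced by
  -- lifted copies.
  have h1 (φ' : Weight.{w, u, k} V) : ClosedUnderColims
      (ULift.down.{t} : ULift.{t} (EnrichedFunctor V ψ.Kᵒᵖ V) → _) φ'.functor :=
    .of_surjective ULift.down_surjective (hasColims_functorVCat (hV φ'))
  have h2 (φ' : Weight.{w, u, k} V) : ClosedUnderColims
      (ULift.down.{max w k t} : ULift.{max w k t} V → _) φ'.functor :=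
    .of_surjective ULift.down_surjective (hV φ')
  have h3 : PreservesColims φ.functor (liftFunctor ULift.down (representable ψ.functor) :
      EnrichedFunctor V (Lifted.{t} (EnrichedFunctor V ψ.Kᵒᵖ V)) (Lifted.{max w k t} V)) :=
    saturation_preservesColims hφ (fun φ' _ => (h1 φ').hasColims) (fun φ' _ => (h2 φ').hasColims)
      fun φ' hφ' => (h1 φ').preservesColims_liftFunctor ((commutesWith_iff _ _).1 (h φ' hφ'))
  exact preservesColims_of_liftFunctor h3

/-- The weights whose limits commute with `φ`-colimits are closed under saturation. -/
lemma commutesWith_of_mem_saturation_right {Ψ : Set (Weight.{w, u, k} V)}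
    {φ ψ : Weight.{w, u, k} V} (hψ : ψ ∈ saturation.{w, u, k, t} Ψ)
    (h : ∀ ψ' ∈ Ψ, CommutesWith φ ψ') : CommutesWith φ ψ := by
  simp only [commutesWith_iff] at h ⊢
  have hV (φ' : Weight.{w, u, k} V) : HasColims φ'.functor V := hasColims_self _
  -- The full subcategory of objects whose representable preserves `φ`-colimits.
  let f : ULift.{t} {F : EnrichedFunctor V ψ.Kᵒᵖ V //
    PreservesColims φ.functor (representable (V := V) F)} → EnrichedFunctor V ψ.Kᵒᵖ V :=
      fun x => x.down.1
  have h1 (ψ' : Weight.{w, u, k} V) (hψ' : ψ' ∈ Ψ) : ClosedUnderColims f ψ'.functor := fun T => by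
    obtain ⟨c, m, hm, hc⟩ := hasColims_functorVCat (hV ψ') (forgetInduced T)
    exact ⟨⟨c, preservesColims_representable_colim hm hc (fun j => (T.obj j).unop.down.2)
      (h ψ' hψ')⟩, m, hm, hc⟩
  have h2 (φ' : Weight.{w, u, k} V) : ClosedUnderColims
      (ULift.down.{t} : ULift.{t} (EnrichedFunctor V ψ.Kᵒᵖ V) → _) φ'.functor :=
    .of_surjective ULift.down_surjective (hasColims_functorVCat (hV φ'))
  have h3 : HasColims ψ.functor (Induced f) :=
    saturation_hasColims hψ _ fun ψ' hψ' => (h1 ψ' hψ').hasColims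
  -- The inclusion into a lifted copy of `[Kᵒᵖ, V]`: it preserves `Ψ`-colimits by closure, hence
  -- `ψ`-colimits by saturation.
  have h4 : PreservesColims ψ.functor (liftFunctor f (EnrichedFunctor.id V _) :
      EnrichedFunctor V _ (Lifted.{t} (EnrichedFunctor V ψ.Kᵒᵖ V))) :=
    saturation_preservesColims hψ (fun ψ' hψ' => (h1 ψ' hψ').hasColims)
      (fun ψ' _ => (h2 ψ').hasColims)
      fun ψ' hψ' => (h1 ψ' hψ').preservesColims_liftFunctor (preservesColims_id _)
  -- The Yoneda embedding factors through the subcategory because representables are atomic.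
  let Y : EnrichedFunctor V ψ.K (Induced f) :=
    { obj x := ⟨⟨(yonedaFunctor V ψ.K).obj x, preservesColims_representable_yoneda (hV φ) x⟩⟩
      map x y := (yonedaFunctor V ψ.K).map x y
      map_id x := (yonedaFunctor V ψ.K).map_id x
      map_comp x y z := (yonedaFunctor V ψ.K).map_comp x y z }
  obtain ⟨c, m, hm, hc⟩ := h3 (opFunctor Y)
  have h5 : IsColim ψ.functor (t := fun j => (yonedaFunctor V ψ.K).obj j.unop) (c := f c)
      (fun i j => (yonedaFunctor V ψ.K).map j.unop i.unop) m :=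
    (isColim_congr (fun _ _ => Category.comp_id _) fun _ => Category.comp_id _).1
      (IsColim.of_induced (f := ULift.down) ULift.down_surjective (h4 _ c m hm hc))
  obtain ⟨hy, hy'⟩ := isColim_yoneda ψ.functor
  -- In `[Kᵒᵖ, V]` both `f c` and `ψ` are the `ψ`-weighted colimit of the Yoneda embedding. They are
  -- therefore isomorphic, and atomicity passes from `f c` to `ψ`.
  obtain ⟨p, q, hpq, hqp, -⟩ := h5.exists_iso (c := f c) hm hy' hy
  exact c.down.2.representable_of_iso p q hpq hqp

end Main

end EnrichedWeights

theorem proposition5p1 {V : Type u} [Category.{w} V] [MonoidalCategory V] [SymmetricCategory V]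
    [MonoidalClosed V] [HasLimits V] [HasColimits V]
    (Φ Ψ : Set (EnrichedWeights.Weight.{w, u, k} V)) :
    EnrichedWeights.IsSaturated.{w, u, k, t} (EnrichedWeights.flat Ψ) ∧
    EnrichedWeights.IsSaturated.{w, u, k, t} (EnrichedWeights.atomic Φ) ∧
    EnrichedWeights.flat Ψ =
      EnrichedWeights.flat (EnrichedWeights.saturation.{w, u, k, t} Ψ) ∧
    EnrichedWeights.atomic Φ =
      EnrichedWeights.atomic (EnrichedWeights.saturation.{w, u, k, t} Φ) := by
  open EnrichedWeights in
  refine ⟨Set.Subset.antisymm ?_ (subset_saturation _),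
    Set.Subset.antisymm ?_ (subset_saturation _),
    Set.Subset.antisymm ?_ ?_, Set.Subset.antisymm ?_ ?_⟩
  · exact fun φ hφ ψ hψ => commutesWith_of_mem_saturation_left hφ fun φ' hφ' => hφ' ψ hψ
  · exact fun ψ hψ φ hφ => commutesWith_of_mem_saturation_right hψ fun ψ' hψ' => hψ' φ hφ
  · exact fun φ hφ ψ hψ => commutesWith_of_mem_saturation_right hψ fun ψ' hψ' => hφ ψ' hψ'
  · exact fun φ hφ ψ hψ => hφ ψ (subset_saturation _ hψ)
  · exact fun ψ hψ φ hφ => commutesWith_of_mem_saturation_left hφ fun φ' hφ' => hψ φ' hφ'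
  · exact fun ψ hψ φ hφ => hψ φ (subset_saturation _ hφ)
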